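/- **Setting.** For matrices $A_1,\dots,A_m\in\mathbb R^{n_1\times n_2}$ let $\mathcal M(X)=(\langle X,A_i\rangle)_{i=1}^m$, where $\langle\cdot,\cdot\rangle$ is the Hilbert–Schmidt inner product. $\mathcal M$ is a *mean-zero, unit-variance sub-Gaussian linear map with parameter $K>0$* if all entries of all $A_i$ are i.i.d. random variables $\xi$ with $\mathbb E\xi=0$, $\operatorname{Var}\xi=1$ and $\mathbb P(|\xi|>t)\le e^{1-t^2/K}$ for all $t\ge 0$. $\|\cdot\|_F$ is the Frobenius norm, $\|\cdot\|_*$ the nuclear norm (the sum of the singular values), and $\sigma_k(X)_*=\min_{\operatorname{rank}V\le k}\|X-V\|_*$. $D\in\mathbb R^{m\times m}$ is the difference matrix with $1$ on the diagonal, $-1$ on the subdiagonal and $0$ elsewhere. An *$r$-th order $\Sigma\Delta$ scheme with step size $\beta>0$* consists of a finite nonempty alphabet $\mathcal A\subset\mathbb R$ whose consecutive elements differ by $\beta$ (for example $\{\pm(j-\tfrac12)\beta : j=1,\dots,L\}$), a scalar quantizer $Q_{\mathcal A}$ sending each real number to a closest element of $\mathcal A$, and a function $\rho_r:\mathbb R^r\times\mathbb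 R\to\mathbb R$. The quantization $q\in\mathcal A^m$ of $y\in\mathbb R^m$ and the state $u\in\mathbb R^m$ are determined recursively, with $u_i=0$ for $i\le 0$, by $$q_i=Q_{\mathcal A}\big(\rho_r(u_{i-1},\dots,u_{i-r},y_i)\big),\qquad D^ru=y-q .$$ The scheme is *stable with constant $\gamma>0$ on the input range $\mu$* if $\|u\|_\infty\le\gamma\beta$ for every input $y$, of any length, with $\|y\|_\infty\le\mu$. Given $q$ and $\varepsilon\ge0$, the decoder is $$(X^\sharp,\nu^\sharp)\in\arg\min_{(Z,\nu)}\|Z\|_*\quad\text{subject to}\quad \|D^{-r}(\mathcal M(Z)+\nu-q)\|_2\le\gamma\beta\sqrt m,\quad \|\nu\|_2\le\varepsilon\sqrt m .$$ **Theorem.** Let $K>0$ and let $r\ge1$ be an integer. There are constants $c_1,c_2,c_3>0$ depending only on $K$ and $r$, and for every $\gamma>0$ a constant $C>0$ depending only on $K$, $r$ and $\gamma$, such that the following holds for all nonnegative integers $n_1,n_2,m,k,\ell$ with $k\ge1$ and $m\ge\ell\ge c_1k\max\{n_1,n_2\}$. Let $\mathcal M:\mathbb R^{n_1\times n_2}\to\mathbb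 R^m$ be a mean-zero, unit-variance sub-Gaussian linear map with parameter $K$. Then, with probability exceeding $1-c_2e^{-c_3\ell}$ on the draw of $\mathcal M$, the following holds for every $r$-th order $\Sigma\Delta$ scheme that has some step size $\beta>0$ and is stable with constant $\gamma$ on some input range $\mu$. For every $\varepsilon\ge0$, every $X\in\mathbb R^{n_1\times n_2}$ and every $e\in\mathbb R^m$ with $\|e\|_\infty\le\varepsilon$ and $\|\mathcal M(X)+e\|_\infty\le\mu$, if $q$ is the quantization of $\mathcal M(X)+e$ by this scheme, then every solution $(X^\sharp,\nu^\sharp)$ of the decoder satisfies $$\|X^\sharp-X\|_F\le C\left(\Big(\frac m\ell\Big)^{-r+1/2}\beta+\frac{\sigma_k(X)_*}{\sqrt k}+\sqrt{\frac m\ell}\,\varepsilon\right).$$ -/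

import Mathlib

noncomputable section

namespace LowRankSD

/-! ### Matrix and vector norms -/

/-- The nuclear norm: the sum of the singular values `σ₁(A) ≥ ⋯ ≥ σₙ(A)`, `n = min n₁ n₂`
(Mathlib indexes them from `0`). -/
def nuclearNorm {n₁ n₂ : ℕ} (A : Matrix (Fin n₁) (Fin n₂) ℝ) : ℝ :=
  ∑ i ∈ Finset.range (min n₁ n₂), (Matrix.toEuclideanLin A).singularValues i

/-- The Frobenius norm. -/
def frobeniusNorm {n₁ n₂ : ℕ} (A : Matrix (Fin n₁) (Fin n₂) ℝ) : ℝ :=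
  √(∑ a, ∑ b, A a b ^ 2)

/-- `σ_k(X)_*`: the error, in the nuclear norm, of the best approximation of `X` by matrices of
rank at most `k`. -/
def bestRankError {n₁ n₂ : ℕ} (k : ℕ) (X : Matrix (Fin n₁) (Fin n₂) ℝ) : ℝ :=
  sInf {t : ℝ | ∃ V : Matrix (Fin n₁) (Fin n₂) ℝ, V.rank ≤ k ∧ t = nuclearNorm (X - V)}

/-- The Euclidean norm of a vector of `ℝᵐ`. (The norm `‖v‖` that Mathlib puts on `Fin m → ℝ` is
the sup norm `‖v‖_∞`.) -/
def l2Norm {m : ℕ} (v : Fin m → ℝ) : ℝ :=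
  √(∑ i, v i ^ 2)

/-! ### Random linear measurements -/

/-- The linear map `X ↦ (⟨X, Aᵢ⟩)ᵢ` given by matrices `A₁, …, A_m`, with the Hilbert–Schmidt
inner product. -/
def measure {m n₁ n₂ : ℕ} (A : Fin m → Matrix (Fin n₁) (Fin n₂) ℝ)
    (X : Matrix (Fin n₁) (Fin n₂) ℝ) : Fin m → ℝ :=
  fun i => ∑ a, ∑ b, X a b * A i a b

/-- `A` is (the family of matrices of) a random mean zero, unit variance sub-Gaussian linear map
with parameter `K`: its entries are independent and identically distributed random variables `ξ`
with `𝔼 ξ = 0`, `Var ξ = 1` and `ℙ(|ξ| > t) ≤ exp (1 - t² / K)` for all `t ≥ 0`. -/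
structure IsSubGaussianMap {Ω : Type*} [MeasurableSpace Ω] (P : MeasureTheory.Measure Ω)
    {m n₁ n₂ : ℕ} (K : ℝ) (A : Ω → Fin m → Matrix (Fin n₁) (Fin n₂) ℝ) : Prop where
  measurable : ∀ i a b, Measurable fun ω => A ω i a b
  indep : ProbabilityTheory.iIndepFun
    (fun (p : Fin m × Fin n₁ × Fin n₂) (ω : Ω) => A ω p.1 p.2.1 p.2.2) P
  identDistrib : ∀ i a b i' a' b',
    ProbabilityTheory.IdentDistrib (fun ω => A ω i a b) (fun ω => A ω i' a' b') P P
  mean_zero : ∀ i a b, ∫ ω, A ω i a b ∂P = 0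
  unit_variance : ∀ i a b, ProbabilityTheory.variance (fun ω => A ω i a b) P = 1
  tail : ∀ i a b, ∀ t : ℝ, 0 ≤ t → P.real {ω | t < |A ω i a b|} ≤ Real.exp (1 - t ^ 2 / K)

/-! ### Sigma-Delta quantization -/

/-- The `m × m` difference matrix `D`: `1` on the diagonal, `-1` on the subdiagonal. -/
def diffMatrix (m : ℕ) : Matrix (Fin m) (Fin m) ℝ :=
  Matrix.of fun i j =>
    if i = j then 1 else if (i : ℕ) = (j : ℕ) + 1 then -1 else 0

/-- `D` has determinant one, so that the matrix inverse in `D⁻ʳ` is the true one. -/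
theorem det_diffMatrix (m : ℕ) : (diffMatrix m).det = 1 := by
  rw [Matrix.det_of_isLowerTriangular]
  · simp [diffMatrix]
  · intro i j hij
    have h : i < j := by simpa using hij
    have h' : (i : ℕ) < (j : ℕ) := h
    have h1 : i ≠ j := ne_of_lt h
    have h2 : ¬ (i : ℕ) = (j : ℕ) + 1 := by omega
    simp [diffMatrix, h1, h2]

/-- The data of an `r`-th order Sigma-Delta scheme: a finite alphabet with step size `step`
(consecutive elements differ by `step`), a scalar quantizer that sends every real number to a
closest element of the alphabet (ties broken in any way), and the function `ρ_r` of the `r`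
previous state values `u_{i-1}, …, u_{i-r}` and of the current measurement `y_i`, whose value is
fed into the scalar quantizer. -/
structure SigmaDeltaScheme (r : ℕ) where
  alphabet : Set ℝ
  step : ℝ
  step_pos : 0 < step
  alphabet_eq : ∃ (a : ℝ) (N : ℕ), 0 < N ∧ alphabet = {v | ∃ j : ℕ, j < N ∧ v = a + j * step}
  scalarQuantizer : ℝ → ℝ
  scalarQuantizer_mem : ∀ z, scalarQuantizer z ∈ alphabet
  scalarQuantizer_le : ∀ z, ∀ v ∈ alphabet, |scalarQuantizer z - z| ≤ |v - z|
  rule : (Fin r → ℝ) → ℝ → ℝ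

/-- The `r` state values before time `i`, most recent first: entry `j` is `u_{i-1-j}`, and it is
`0` when this index lies before the start. -/
def previousStates {m : ℕ} (r : ℕ) (u : Fin m → ℝ) (i : Fin m) : Fin r → ℝ :=
  fun j => if _h : (j : ℕ) + 1 ≤ (i : ℕ) then u ⟨(i : ℕ) - 1 - j, by omega⟩ else 0

/-- On the input `y`, the scheme runs through the states `u` and outputs `q`: the state equations
`q_i = Q(ρ_r(u_{i-1}, …, u_{i-r}, y_i))` and `Dʳ u = y - q`. The latter is `(Δʳ u)_i = y_i - q_i`
with `u_i = 0` for `i ≤ 0`, so that `u` and `q` are determined by `y` recursively. -/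
structure SigmaDeltaScheme.IsRun {r m : ℕ} (S : SigmaDeltaScheme r) (y u q : Fin m → ℝ) :
    Prop where
  output : ∀ i, q i = S.scalarQuantizer (S.rule (previousStates r u i) (y i))
  state : y - q = ((diffMatrix m) ^ r).mulVec u

/-- `q` is the Sigma-Delta quantization of `y`. -/
def SigmaDeltaScheme.IsQuantization {r m : ℕ} (S : SigmaDeltaScheme r) (y q : Fin m → ℝ) : Prop :=
  ∃ u, S.IsRun y u q

/-- The scheme is stable, with stability constant `τ`, for inputs of sup norm at most `μ`: whatever
the length of the input, all states are bounded by `τ`. -/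
def SigmaDeltaScheme.IsStable {r : ℕ} (S : SigmaDeltaScheme r) (μ τ : ℝ) : Prop :=
  ∀ (m : ℕ) (y u q : Fin m → ℝ), S.IsRun y u q → ‖y‖ ≤ μ → ∀ i, |u i| ≤ τ

/-! ### The decoder -/

/-- `(Z, ν)` satisfies the constraints of the decoder:
`‖D⁻ʳ(M(Z) + ν - q)‖₂ ≤ τ √m` and `‖ν‖₂ ≤ ε √m`. -/
def IsFeasible {m n₁ n₂ : ℕ} (A : Fin m → Matrix (Fin n₁) (Fin n₂) ℝ) (r : ℕ) (τ ε : ℝ)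
    (q : Fin m → ℝ) (Z : Matrix (Fin n₁) (Fin n₂) ℝ) (ν : Fin m → ℝ) : Prop :=
  l2Norm (((diffMatrix m) ^ r)⁻¹.mulVec (measure A Z + ν - q)) ≤ τ * √(m : ℝ) ∧
    l2Norm ν ≤ ε * √(m : ℝ)

/-- `(Z, ν)` is a solution of the decoder: it minimizes the nuclear norm `‖Z‖_*` among all feasible
pairs. -/
def IsDecoderSolution {m n₁ n₂ : ℕ} (A : Fin m → Matrix (Fin n₁) (Fin n₂) ℝ) (r : ℕ) (τ ε : ℝ)
    (q : Fin m → ℝ) (Z : Matrix (Fin n₁) (Fin n₂) ℝ) (ν : Fin m → ℝ) : Prop :=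
  IsFeasible A r τ ε q Z ν ∧
    ∀ (Z' : Matrix (Fin n₁) (Fin n₂) ℝ) (ν' : Fin m → ℝ),
      IsFeasible A r τ ε q Z' ν' → nuclearNorm Z ≤ nuclearNorm Z'

end LowRankSD

end

/-! The state equation gives `M(X) + e - q = Dʳ u` with `u` bounded by `γβ`, so the true pair `(X,
e)` is feasible and the error `H = X' - X` satisfies `‖X + H‖_* ≤ ‖X‖_*`. Duality between the
nuclear norm and contractions turns this into the cone condition `‖H‖_* ≤ 4√k ‖H‖_F + 2σ_k(X)_*`
(`nuclearNorm_le_bestRankError`).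

The measurements are compressed by a deterministic `ℓ × m` matrix `T` whose rows are smooth bumps on
disjoint blocks (`exists_block_averages`). The bumps are iterated window sums, so `T Dʳ` telescopes
and has norm at most `(4(r+1)ℓ/m)ʳ`. Since `T` is also a contraction, feasibility of both pairs
gives `‖T M(H)‖₂ ≲ (ℓ/m)ʳ γβ√m + ε√m`. The rows of `T` have disjoint supports and squared norms
between `1/(r+1)` and `1`, so `T M(Z)` has `ℓ` independent sub-Gaussian coordinates of variance
comparable to `‖Z‖_F²`.

It remains to bound `‖T M(H)‖₂` from below on the cone. The unit ball of the nuclear norm lies in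
the convex hull of at most `48^(n₁+n₂)` matrices of rank one (`exists_mem_convexHull_eq_smul`). With
high probability `‖T M(Z)‖₂² ≥ aℓ‖Z‖_F²` holds for every sum `Z` of `N` of them, and `‖T M(Z)‖₂² ≤
bℓ` for each single one; the union bound costs an exponent of order `N(n₁+n₂)`, which is affordable
for `N` of order `k`. Maurey's empirical method (`nonneg_of_mem_convexHull`) carries this to all
matrices with the loss `bℓ‖H‖_*²/(N-1)` (`restricted_eigenvalue`). On the cone a large multiple `N`
of `k` makes half of `aℓ‖H‖_F²` absorb the part of the loss proportional to `‖H‖_F²`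
(`le_of_restricted_eigenvalue`). Division by `√ℓ` produces the three error terms. The event concerns
only `T` and the matrices, so it is uniform over schemes, signals and noise. -/

noncomputable section

open Matrix

namespace LowRankSD

/-! ### Singular value decomposition -/

/-- A singular value decomposition; the left vectors that belong to the singular value `0`
are `0`. -/
theorem exists_svd {n₁ n₂ : ℕ} (A : Matrix (Fin n₁) (Fin n₂) ℝ) :
    ∃ (σ : Fin n₂ → ℝ) (u : Fin n₂ → Fin n₁ → ℝ) (v : Fin n₂ → Fin n₂ → ℝ),
      (∀ i, 0 ≤ σ i) ∧ ∑ i, σ i = nuclearNorm A ∧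
      (Finset.univ.filter fun i => σ i ≠ 0).card ≤ A.rank ∧
      (∀ i j, u i ⬝ᵥ u j = if i = j ∧ σ i ≠ 0 then 1 else 0) ∧
      (∀ i j, v i ⬝ᵥ v j = if i = j then 1 else 0) ∧
      A = ∑ i, σ i • vecMulVec (u i) (v i) := by
  set L := Matrix.toEuclideanLin A with hL
  have hS := L.isSymmetric_adjoint_comp_self
  have hn : Module.finrank ℝ (EuclideanSpace ℝ (Fin n₂)) = n₂ := finrank_euclideanSpace_fin
  set b := hS.eigenvectorBasis hn with hb
  have hrank : Module.finrank ℝ (LinearMap.range L) = A.rank := by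
    rw [hL, Matrix.toEuclideanLin_eq_toLin_orthonormal, ← Matrix.rank_eq_finrank_range_toLin]
  have hinner : ∀ i j, inner ℝ (L (b i)) (L (b j)) =
      if i = j then L.singularValues i ^ 2 else 0 := by
    intro i j
    rw [← LinearMap.adjoint_inner_right]
    have h1 : (LinearMap.adjoint L) (L (b j)) = L.singularValues j ^ 2 • b j := by
      have := hS.apply_eigenvectorBasis hn j
      rw [L.sq_singularValues_fin hn j]
      exact this
    rw [h1, inner_smul_right, orthonormal_iff_ite.mp b.orthonormal i j]
    split_ifs with h
    · subst h; simp
    · simp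
  have hzero : ∀ i : Fin n₂, L.singularValues i = 0 → L (b i) = 0 := by
    intro i hi
    have := hinner i i
    rw [if_pos rfl, hi] at this
    simpa using this
  have hdot : ∀ {n : ℕ} (x y : EuclideanSpace ℝ (Fin n)), (x.ofLp ⬝ᵥ y.ofLp) = inner ℝ x y := by
    intro n x y
    rw [EuclideanSpace.inner_eq_star_dotProduct, dotProduct_comm]
    simp
  -- The left vectors are the normalized images of an eigenbasis of `L* L`. Since `0⁻¹ = 0`, they
  -- vanish where the singular value does.
  refine ⟨fun i => L.singularValues i, fun i => ((L.singularValues i)⁻¹ • L (b i)).ofLp,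
    fun i => (b i).ofLp, fun i => L.singularValues_nonneg i, ?_, ?_, ?_, ?_, ?_⟩
  · rw [nuclearNorm, ← hL, Fin.sum_univ_eq_sum_range (fun i => L.singularValues i) n₂]
    symm
    apply Finset.sum_subset
    · intro i; simp
    · intro i _ hi
      rw [L.singularValues_eq_zero_iff_le_finrank_range, hrank]
      have h1 := A.rank_le_height
      have h2 := A.rank_le_width
      simp at hi h1 h2
      omega
  · rw [← hrank, ← L.card_support_singularValues]
    apply Finset.card_le_card_of_injOn (fun i : Fin n₂ => (i : ℕ))
    · intro i hi
      simpa [-LinearMap.support_singularValues] using hi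
    · intro i _ j _ h
      exact Fin.ext h
  · intro i j
    rw [hdot, inner_smul_left, inner_smul_right, hinner]
    by_cases h : i = j
    · subst h
      by_cases h0 : L.singularValues i = 0
      · simp [h0]
      · simp only [h0, ne_eq, not_false_eq_true, and_self, if_true]
        simp
        field_simp
    · simp [h]
  · intro i j
    rw [hdot, orthonormal_iff_ite.mp b.orthonormal i j]
  · have key : ∀ x : EuclideanSpace ℝ (Fin n₂), A *ᵥ x.ofLp =
        (∑ i : Fin n₂, L.singularValues i •
          vecMulVec ((L.singularValues i)⁻¹ • L (b i)).ofLp (b i).ofLp) *ᵥ x.ofLp := by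
      intro x
      have h1 : A *ᵥ x.ofLp = (L x).ofLp := by rw [hL]; rfl
      have h2 : L x = ∑ i : Fin n₂, inner ℝ (b i) x • L (b i) := by
        conv_lhs => rw [← b.sum_repr' x]
        simp [map_sum]
      rw [h1, h2, Matrix.sum_mulVec]
      simp only [WithLp.ofLp_sum]
      refine Finset.sum_congr rfl fun i _ => ?_
      rw [smul_mulVec, vecMulVec_mulVec]
      rw [hdot]
      by_cases h0 : L.singularValues i = 0
      · simp [h0, hzero i h0]
      · ext a
        simp
        field_simp
    apply Matrix.ext_of_mulVec_single
    intro i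
    exact key (EuclideanSpace.single i 1)


/-! ### Hilbert–Schmidt inner product -/

/-- The Hilbert-Schmidt inner product. -/
def hsInner {n₁ n₂ : ℕ} (A B : Matrix (Fin n₁) (Fin n₂) ℝ) : ℝ := trace (Aᵀ * B)

theorem hsInner_eq_sum {n₁ n₂ : ℕ} (A B : Matrix (Fin n₁) (Fin n₂) ℝ) :
    hsInner A B = ∑ a, ∑ b, A a b * B a b := by
  simp only [hsInner, trace, diag, mul_apply, transpose_apply]
  exact Finset.sum_comm

theorem hsInner_self_nonneg {n₁ n₂ : ℕ} (A : Matrix (Fin n₁) (Fin n₂) ℝ) : 0 ≤ hsInner A A := by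
  rw [hsInner_eq_sum]
  exact Finset.sum_nonneg fun _ _ => Finset.sum_nonneg fun _ _ => mul_self_nonneg _

theorem frobeniusNorm_eq {n₁ n₂ : ℕ} (A : Matrix (Fin n₁) (Fin n₂) ℝ) :
    frobeniusNorm A = √(hsInner A A) := by
  rw [frobeniusNorm, hsInner_eq_sum]
  simp only [pow_two]

theorem frobeniusNorm_nonneg {n₁ n₂ : ℕ} (A : Matrix (Fin n₁) (Fin n₂) ℝ) :
    0 ≤ frobeniusNorm A := Real.sqrt_nonneg _

theorem sq_frobeniusNorm {n₁ n₂ : ℕ} (A : Matrix (Fin n₁) (Fin n₂) ℝ) :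
    frobeniusNorm A ^ 2 = hsInner A A := by
  rw [frobeniusNorm_eq, Real.sq_sqrt (hsInner_self_nonneg A)]

theorem hsInner_le {n₁ n₂ : ℕ} (A B : Matrix (Fin n₁) (Fin n₂) ℝ) :
    hsInner A B ≤ frobeniusNorm A * frobeniusNorm B := by
  apply le_of_sq_le_sq _ (mul_nonneg (frobeniusNorm_nonneg A) (frobeniusNorm_nonneg B))
  rw [mul_pow, sq_frobeniusNorm, sq_frobeniusNorm]
  simp only [hsInner_eq_sum, ← Fintype.sum_prod_type', ← pow_two]
  exact Finset.sum_mul_sq_le_sq_mul_sq _ _ _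

theorem hsInner_add_left {n₁ n₂ : ℕ} (A B C : Matrix (Fin n₁) (Fin n₂) ℝ) :
    hsInner (A + B) C = hsInner A C + hsInner B C := by
  simp [hsInner, Matrix.add_mul]

theorem hsInner_add_right {n₁ n₂ : ℕ} (A B C : Matrix (Fin n₁) (Fin n₂) ℝ) :
    hsInner A (B + C) = hsInner A B + hsInner A C := by
  simp [hsInner, Matrix.mul_add]

theorem hsInner_smul_left {n₁ n₂ : ℕ} (t : ℝ) (A B : Matrix (Fin n₁) (Fin n₂) ℝ) :
    hsInner (t • A) B = t * hsInner A B := by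
  simp [hsInner]

theorem hsInner_smul_right {n₁ n₂ : ℕ} (t : ℝ) (A B : Matrix (Fin n₁) (Fin n₂) ℝ) :
    hsInner A (t • B) = t * hsInner A B := by
  simp [hsInner]

theorem hsInner_sum_left {ι : Type*} (s : Finset ι) {n₁ n₂ : ℕ}
    (A : ι → Matrix (Fin n₁) (Fin n₂) ℝ) (B : Matrix (Fin n₁) (Fin n₂) ℝ) :
    hsInner (∑ i ∈ s, A i) B = ∑ i ∈ s, hsInner (A i) B := by
  simp [hsInner, Matrix.transpose_sum, Matrix.sum_mul, Matrix.trace_sum]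

theorem hsInner_vecMulVec {n₁ n₂ : ℕ} (u : Fin n₁ → ℝ) (v : Fin n₂ → ℝ)
    (B : Matrix (Fin n₁) (Fin n₂) ℝ) : hsInner (vecMulVec u v) B = u ⬝ᵥ (B *ᵥ v) := by
  rw [hsInner_eq_sum]
  simp only [dotProduct, mulVec, vecMulVec_apply, Finset.mul_sum]
  refine Finset.sum_congr rfl fun a _ => Finset.sum_congr rfl fun b _ => by ring

/-- Multiplication by `P` and `Q` from the two sides is moved across the inner product. -/
theorem hsInner_mul_mul {n₁ n₂ : ℕ} (P : Matrix (Fin n₁) (Fin n₁) ℝ)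
    (Q : Matrix (Fin n₂) (Fin n₂) ℝ) (A B : Matrix (Fin n₁) (Fin n₂) ℝ) :
    hsInner A (P * B * Q) = hsInner (Pᵀ * A * Qᵀ) B := by
  simp only [hsInner, transpose_mul, transpose_transpose]
  rw [← Matrix.mul_assoc, trace_mul_comm]
  simp only [Matrix.mul_assoc]

/-! ### Contractions and the dual description of the nuclear norm -/

/-- `W` does not increase Euclidean norms. -/
def IsContraction {n₁ n₂ : ℕ} (W : Matrix (Fin n₁) (Fin n₂) ℝ) : Prop :=
  ∀ x, (W *ᵥ x) ⬝ᵥ (W *ᵥ x) ≤ x ⬝ᵥ x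

theorem zero_le_dotProduct_self {n : ℕ} (x : Fin n → ℝ) : 0 ≤ x ⬝ᵥ x :=
  Finset.sum_nonneg fun _ _ => mul_self_nonneg _

theorem sq_dotProduct_le {n : ℕ} (x y : Fin n → ℝ) : (x ⬝ᵥ y) ^ 2 ≤ (x ⬝ᵥ x) * (y ⬝ᵥ y) := by
  simp only [dotProduct, ← pow_two]
  exact Finset.sum_mul_sq_le_sq_mul_sq _ _ _

/-- For `z = Wᵀ y`, Cauchy–Schwarz on `z ⬝ᵥ z = y ⬝ᵥ W z` gives `|z|⁴ ≤ |y|² |W z|² ≤ |y|² |z|²`,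
and `|z|²` cancels. -/
theorem IsContraction.transpose {n₁ n₂ : ℕ} {W : Matrix (Fin n₁) (Fin n₂) ℝ}
    (hW : IsContraction W) : IsContraction Wᵀ := by
  intro y
  set z := Wᵀ *ᵥ y with hz
  have h1 : z ⬝ᵥ z = y ⬝ᵥ (W *ᵥ z) := by
    rw [dotProduct_comm y, hz, dotProduct_mulVec, vecMul_transpose]
  have h2 := sq_dotProduct_le y (W *ᵥ z)
  rw [← h1] at h2
  have h3 := hW z
  have h4 := zero_le_dotProduct_self y
  have h5 := zero_le_dotProduct_self z
  by_contra! h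
  nlinarith

theorem IsContraction.neg {n₁ n₂ : ℕ} {W : Matrix (Fin n₁) (Fin n₂) ℝ}
    (hW : IsContraction W) : IsContraction (-W) := by
  intro y
  simpa [neg_mulVec] using hW y

theorem IsContraction.mul {n₁ n₂ n₃ : ℕ} {W : Matrix (Fin n₁) (Fin n₂) ℝ}
    {V : Matrix (Fin n₂) (Fin n₃) ℝ} (hW : IsContraction W) (hV : IsContraction V) :
    IsContraction (W * V) := by
  intro y
  rw [← mulVec_mulVec]
  exact (hW _).trans (hV y)

/-- Pythagoras. The predicate `p` marks the nonzero vectors, so the left vectors of `exists_svd` are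
covered without reindexing. -/
theorem sum_smul_dotProduct_self {ι : Type*} [Fintype ι] [DecidableEq ι] {n : ℕ}
    {w : ι → Fin n → ℝ} {p : ι → Prop} [DecidablePred p]
    (hw : ∀ i j, w i ⬝ᵥ w j = if i = j ∧ p i then 1 else 0) (c : ι → ℝ) :
    (∑ i, c i • w i) ⬝ᵥ (∑ i, c i • w i) = ∑ i, if p i then c i ^ 2 else 0 := by
  rw [sum_dotProduct]
  refine Finset.sum_congr rfl fun i _ => ?_
  rw [dotProduct_sum, Finset.sum_eq_single i]
  · rw [smul_dotProduct, dotProduct_smul, hw]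
    by_cases h : p i <;> simp [h, pow_two]
  · intro j _ hj
    rw [smul_dotProduct, dotProduct_smul, hw, if_neg (fun h => hj h.1.symm)]
    simp
  · simp

/-- Bessel's inequality for a family that is orthonormal up to vectors `0`. -/
theorem sum_sq_dotProduct_le {ι : Type*} [Fintype ι] [DecidableEq ι] {n : ℕ}
    {w : ι → Fin n → ℝ} {p : ι → Prop} [DecidablePred p]
    (hw : ∀ i j, w i ⬝ᵥ w j = if i = j ∧ p i then 1 else 0) (x : Fin n → ℝ) :
    ∑ i, (w i ⬝ᵥ x) ^ 2 ≤ x ⬝ᵥ x := by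
  set z := ∑ i, (w i ⬝ᵥ x) • w i with hz
  have h1 : z ⬝ᵥ x = ∑ i, (w i ⬝ᵥ x) ^ 2 := by
    rw [hz, sum_dotProduct]
    refine Finset.sum_congr rfl fun i _ => ?_
    rw [smul_dotProduct, smul_eq_mul, pow_two]
  have h2 : z ⬝ᵥ z ≤ ∑ i, (w i ⬝ᵥ x) ^ 2 := by
    rw [hz, sum_smul_dotProduct_self hw]
    refine Finset.sum_le_sum fun i _ => ?_
    split_ifs
    · exact le_rfl
    · positivity
  have h3 := zero_le_dotProduct_self (x - z)
  rw [sub_dotProduct, dotProduct_sub, dotProduct_sub, dotProduct_comm x z, h1] at h3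
  linarith

/-- The witness is the polar factor `∑ uᵢ vᵢᵀ`, a partial isometry. Together with
`IsContraction.hsInner_le` it presents the nuclear norm as a maximum over contractions, which
replaces the triangle inequality below. -/
theorem exists_contraction_hsInner_eq {n₁ n₂ : ℕ} (A : Matrix (Fin n₁) (Fin n₂) ℝ) :
    ∃ W, IsContraction W ∧ hsInner A W = nuclearNorm A := by
  obtain ⟨σ, u, v, hσ, hsum, -, hu, hv, hA⟩ := exists_svd A
  have hWx : ∀ x, (∑ i, vecMulVec (u i) (v i)) *ᵥ x = ∑ i, (v i ⬝ᵥ x) • u i := by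
    intro x
    rw [sum_mulVec]
    refine Finset.sum_congr rfl fun i _ => ?_
    rw [vecMulVec_mulVec]
    simp
  refine ⟨∑ i, vecMulVec (u i) (v i), ?_, ?_⟩
  · intro x
    rw [hWx, sum_smul_dotProduct_self hu]
    refine le_trans ?_ (sum_sq_dotProduct_le (p := fun _ => True) (w := v) (by simpa using hv) x)
    refine Finset.sum_le_sum fun i _ => ?_
    split_ifs
    · exact le_rfl
    · positivity
  · conv_lhs => rw [hA]
    rw [hsInner_sum_left, ← hsum]
    refine Finset.sum_congr rfl fun i _ => ?_
    rw [hsInner_smul_left, hsInner_vecMulVec, hWx]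
    simp only [hv, ite_smul, one_smul, zero_smul, Finset.sum_ite_eq', Finset.mem_univ, if_true]
    rw [hu]
    by_cases h : σ i = 0 <;> simp [h]

theorem IsContraction.hsInner_le {n₁ n₂ : ℕ} {W : Matrix (Fin n₁) (Fin n₂) ℝ}
    (hW : IsContraction W) (A : Matrix (Fin n₁) (Fin n₂) ℝ) : hsInner A W ≤ nuclearNorm A := by
  obtain ⟨σ, u, v, hσ, hsum, -, hu, hv, hA⟩ := exists_svd A
  conv_lhs => rw [hA]
  rw [hsInner_sum_left, ← hsum]
  refine Finset.sum_le_sum fun i _ => ?_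
  rw [hsInner_smul_left, hsInner_vecMulVec]
  apply mul_le_of_le_one_right (hσ i)
  have h1 := sq_dotProduct_le (u i) (W *ᵥ v i)
  have h2 := hW (v i)
  have h3 : u i ⬝ᵥ u i ≤ 1 := by rw [hu]; split_ifs <;> norm_num
  have h4 := zero_le_dotProduct_self (u i)
  rw [hv, if_pos rfl] at h2
  have h5 := zero_le_dotProduct_self (W *ᵥ v i)
  nlinarith

theorem nuclearNorm_nonneg {n₁ n₂ : ℕ} (A : Matrix (Fin n₁) (Fin n₂) ℝ) : 0 ≤ nuclearNorm A :=
  Finset.sum_nonneg fun _ _ => LinearMap.singularValues_nonneg _ _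

/-! ### Projections onto row and column spaces -/

/-- The orthogonal projection onto the span of a family that is orthonormal up to vectors `0`. -/
def projection {ι : Type*} [Fintype ι] {n : ℕ} (w : ι → Fin n → ℝ) : Matrix (Fin n) (Fin n) ℝ :=
  ∑ i, vecMulVec (w i) (w i)

section Projection

variable {ι : Type*} [Fintype ι] {n : ℕ} {w : ι → Fin n → ℝ} {p : ι → Prop}
  [DecidablePred p]

theorem transpose_projection (w : ι → Fin n → ℝ) : (projection w)ᵀ = projection w := by
  simp [projection, transpose_sum, transpose_vecMulVec]

theorem projection_mulVec (w : ι → Fin n → ℝ) (x : Fin n → ℝ) :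
    projection w *ᵥ x = ∑ i, (w i ⬝ᵥ x) • w i := by
  rw [projection, sum_mulVec]
  refine Finset.sum_congr rfl fun i _ => ?_
  rw [vecMulVec_mulVec]
  simp

theorem projection_mulVec_self [DecidableEq ι]
    (hw : ∀ i j, w i ⬝ᵥ w j = if i = j ∧ p i then 1 else 0) (i : ι) :
    projection w *ᵥ w i = w i := by
  rw [projection_mulVec, Finset.sum_eq_single i]
  · rw [hw]
    by_cases h : p i
    · simp [h]
    · have : w i ⬝ᵥ w i = 0 := by rw [hw, if_neg (fun h' => h h'.2)]
      rw [dotProduct_self_eq_zero.mp this]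
      simp
  · intro j _ hj
    rw [hw, if_neg (fun h => hj h.1)]
    simp
  · simp

theorem projection_mul_self [DecidableEq ι]
    (hw : ∀ i j, w i ⬝ᵥ w j = if i = j ∧ p i then 1 else 0) :
    projection w * projection w = projection w := by
  conv_lhs => rhs; rw [projection]
  rw [Finset.mul_sum]
  conv_rhs => rw [projection]
  refine Finset.sum_congr rfl fun i _ => ?_
  rw [mul_vecMulVec, projection_mulVec_self hw]

/-- The squared Frobenius norm of `W` times the projection is `∑ |W wᵢ|²`, and only the nonzero `wᵢ`
contribute, each at most one. -/
theorem IsContraction.hsInner_mul_projection_le [DecidableEq ι]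
    {n' : ℕ} {W : Matrix (Fin n') (Fin n) ℝ}
    (hW : IsContraction W) (hw : ∀ i j, w i ⬝ᵥ w j = if i = j ∧ p i then 1 else 0) :
    hsInner (W * projection w) (W * projection w) ≤ (Finset.univ.filter p).card := by
  have h1 : hsInner (W * projection w) (W * projection w) =
      ∑ i, (W *ᵥ w i) ⬝ᵥ (W *ᵥ w i) := by
    rw [hsInner, transpose_mul, transpose_projection, Matrix.mul_assoc, trace_mul_comm,
      Matrix.mul_assoc, Matrix.mul_assoc, projection_mul_self hw, projection, Matrix.mul_sum,
      Matrix.mul_sum, trace_sum]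
    refine Finset.sum_congr rfl fun i _ => ?_
    rw [mul_vecMulVec, mul_vecMulVec, trace_vecMulVec, mulVec_transpose, ← dotProduct_mulVec]
  rw [h1, Finset.card_filter]
  push_cast
  refine Finset.sum_le_sum fun i _ => (hW _).trans ?_
  rw [hw]
  by_cases h : p i <;> simp [h]

end Projection

theorem dotProduct_self_eq_add {n : ℕ} {P : Matrix (Fin n) (Fin n) ℝ} (hP : Pᵀ = P)
    (hP2 : P * P = P) (x : Fin n → ℝ) :
    x ⬝ᵥ x = (P *ᵥ x) ⬝ᵥ (P *ᵥ x) + ((1 - P) *ᵥ x) ⬝ᵥ ((1 - P) *ᵥ x) := by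
  have h1 : (P *ᵥ x) ⬝ᵥ (P *ᵥ x) = x ⬝ᵥ (P *ᵥ x) := by
    rw [dotProduct_mulVec, ← mulVec_transpose, hP, mulVec_mulVec, hP2, dotProduct_comm]
  have h2 : (1 - P) *ᵥ x = x - P *ᵥ x := by rw [sub_mulVec, one_mulVec]
  rw [h2, sub_dotProduct, dotProduct_sub, dotProduct_sub, h1, dotProduct_comm (P *ᵥ x) x]
  ring

theorem exists_projections {n₁ n₂ k : ℕ} (V : Matrix (Fin n₁) (Fin n₂) ℝ) (hV : V.rank ≤ k) :
    ∃ (P : Matrix (Fin n₁) (Fin n₁) ℝ) (Q : Matrix (Fin n₂) (Fin n₂) ℝ),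
      Pᵀ = P ∧ P * P = P ∧ Qᵀ = Q ∧ Q * Q = Q ∧ P * V = V ∧ V * Q = V ∧
      (∀ (n : ℕ) (W : Matrix (Fin n) (Fin n₁) ℝ), IsContraction W →
        hsInner (W * P) (W * P) ≤ k) ∧
      (∀ (n : ℕ) (W : Matrix (Fin n) (Fin n₂) ℝ), IsContraction W →
        hsInner (W * Q) (W * Q) ≤ k) := by
  obtain ⟨σ, u, v, hσ, -, hcard, hu, hv, hA⟩ := exists_svd V
  have hk : ((Finset.univ.filter fun i => σ i ≠ 0).card : ℝ) ≤ k := by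
    exact_mod_cast hcard.trans hV
  -- The right singular vectors form a full orthonormal basis; those belonging to the singular value
  -- `0` are discarded to obtain the row space of `V`.
  set v' : Fin n₂ → Fin n₂ → ℝ := fun i => if σ i ≠ 0 then v i else 0 with hv'
  have hvw : ∀ i j, v' i ⬝ᵥ v' j = if i = j ∧ σ i ≠ 0 then 1 else 0 := by
    intro i j
    simp only [hv']
    by_cases h : i = j
    · subst h
      by_cases h0 : σ i = 0 <;> simp [h0, hv]
    · by_cases h0 : σ i = 0 <;> by_cases h1 : σ j = 0 <;> simp [h0, h1, hv, h]
  refine ⟨projection u, projection v', transpose_projection _, projection_mul_self hu,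
    transpose_projection _, projection_mul_self hvw, ?_, ?_,
    fun n W hW => (hW.hsInner_mul_projection_le hu).trans hk,
    fun n W hW => (hW.hsInner_mul_projection_le hvw).trans hk⟩
  · conv_lhs => rw [hA]
    conv_rhs => rw [hA]
    rw [Matrix.mul_sum]
    refine Finset.sum_congr rfl fun i _ => ?_
    rw [Matrix.mul_smul, mul_vecMulVec, projection_mulVec_self hu]
  · conv_lhs => rw [hA]
    conv_rhs => rw [hA]
    rw [Matrix.sum_mul]
    refine Finset.sum_congr rfl fun i _ => ?_
    by_cases h0 : σ i = 0
    · simp [h0]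
    · have hvi : v i = v' i := by simp [hv', h0]
      rw [Matrix.smul_mul, vecMulVec_mul, ← mulVec_transpose, transpose_projection, hvi,
        projection_mulVec_self hvw]

/-! ### The cone condition -/

/-- An error that does not increase the nuclear norm is nearly of low rank. -/
theorem nuclearNorm_le_of_nuclearNorm_add_le {n₁ n₂ k : ℕ} (X H V : Matrix (Fin n₁) (Fin n₂) ℝ)
    (hV : V.rank ≤ k) (hXH : nuclearNorm (X + H) ≤ nuclearNorm X) :
    nuclearNorm H ≤ 4 * √k * frobeniusNorm H + 2 * nuclearNorm (X - V) := by
  obtain ⟨P, Q, hP, hP2, hQ, hQ2, hPV, hVQ, hPk, hQk⟩ := exists_projections V hV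
  have hcQ : ∀ y, (Q *ᵥ y) ⬝ᵥ (Q *ᵥ y) + ((1 - Q) *ᵥ y) ⬝ᵥ ((1 - Q) *ᵥ y) = y ⬝ᵥ y :=
    fun y => (dotProduct_self_eq_add hQ hQ2 y).symm
  have hP' : (1 - P)ᵀ = 1 - P := by rw [transpose_sub, transpose_one, hP]
  have hQ' : (1 - Q)ᵀ = 1 - Q := by rw [transpose_sub, transpose_one, hQ]
  have hPP' : P * (1 - P) = 0 := by rw [mul_sub, mul_one, hP2, sub_self]
  have hP'P : (1 - P) * P = 0 := by rw [sub_mul, one_mul, hP2, sub_self]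
  have hP'2 : (1 - P) * (1 - P) = 1 - P := by rw [sub_mul, one_mul, hPP', sub_zero]
  have hQQ' : Q * (1 - Q) = 0 := by rw [mul_sub, mul_one, hQ2, sub_self]
  have hQ'2 : (1 - Q) * (1 - Q) = 1 - Q := by rw [sub_mul, one_mul, hQQ', sub_zero]
  have hP'c : IsContraction (1 - P) := by
    intro x
    have := dotProduct_self_eq_add hP hP2 x
    have h := zero_le_dotProduct_self (P *ᵥ x)
    linarith
  -- `Hc` is the corner of `H` orthogonal to the row and column spaces of `V`; the rest `H₀` is
  -- supported on at most `k` columns' and `k` rows' worth of directions.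
  set Hc := (1 - P) * H * (1 - Q) with hHc
  set H₀ := P * H + (1 - P) * H * Q with hH₀
  have hH : H = H₀ + Hc := by
    simp only [hH₀, hHc, Matrix.sub_mul, Matrix.mul_sub, Matrix.one_mul, Matrix.mul_one]
    abel
  -- the part near the singular spaces of `V`
  have hH₀W : ∀ W, IsContraction W → hsInner H₀ W ≤ 2 * √k * frobeniusNorm H := by
    intro W hW
    have e1 : hsInner (P * H) W = hsInner H (P * W) := by
      have := hsInner_mul_mul P 1 H W
      simpa [hP] using this.symm
    have e2 : hsInner ((1 - P) * H * Q) W = hsInner H ((1 - P) * W * Q) := by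
      have := hsInner_mul_mul (1 - P) Q H W
      rw [hP', hQ] at this
      exact this.symm
    have f1 : frobeniusNorm (P * W) ≤ √k := by
      rw [frobeniusNorm_eq]
      apply Real.sqrt_le_sqrt
      have := hPk _ _ hW.transpose
      rwa [hsInner, trace_mul_comm, transpose_mul, hP, transpose_transpose,
        ← hP, ← transpose_mul, ← hsInner, hP] at this
    have f2 : frobeniusNorm ((1 - P) * W * Q) ≤ √k := by
      rw [frobeniusNorm_eq]
      exact Real.sqrt_le_sqrt (hQk _ _ (hP'c.mul hW))
    have g1 := hsInner_le H (P * W)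
    have g2 := hsInner_le H ((1 - P) * W * Q)
    have g3 := frobeniusNorm_nonneg H
    rw [hH₀, hsInner_add_left, e1, e2]
    nlinarith
  obtain ⟨W₁, hW₁, e₁⟩ := exists_contraction_hsInner_eq V
  obtain ⟨W₂, hW₂, e₂⟩ := exists_contraction_hsInner_eq Hc
  -- Both blocks act between orthogonal pairs of subspaces, so `W` is still a contraction, and it
  -- attains the nuclear norms of `V` and of `Hc` at once.
  set W := P * W₁ * Q + (1 - P) * W₂ * (1 - Q) with hW
  have hWc : IsContraction W := by
    intro x
    have a1 : P *ᵥ (W *ᵥ x) = P *ᵥ (W₁ *ᵥ (Q *ᵥ x)) := by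
      simp only [mulVec_mulVec]
      congr 1
      rw [hW, Matrix.mul_add, ← Matrix.mul_assoc, ← Matrix.mul_assoc, ← Matrix.mul_assoc,
        ← Matrix.mul_assoc, hP2, hPP']
      simp [Matrix.mul_assoc]
    have a2 : (1 - P) *ᵥ (W *ᵥ x) = (1 - P) *ᵥ (W₂ *ᵥ ((1 - Q) *ᵥ x)) := by
      simp only [mulVec_mulVec]
      congr 1
      rw [hW, Matrix.mul_add, ← Matrix.mul_assoc, ← Matrix.mul_assoc, ← Matrix.mul_assoc,
        ← Matrix.mul_assoc, hP'P, hP'2]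
      simp [Matrix.mul_assoc]
    rw [dotProduct_self_eq_add hP hP2 (W *ᵥ x), a1, a2, ← hcQ x]
    have b1 := dotProduct_self_eq_add hP hP2 (W₁ *ᵥ (Q *ᵥ x))
    have b2 := hW₁ (Q *ᵥ x)
    have b3 := zero_le_dotProduct_self ((1 - P) *ᵥ (W₁ *ᵥ (Q *ᵥ x)))
    have b4 := hP'c (W₂ *ᵥ ((1 - Q) *ᵥ x))
    have b5 := hW₂ ((1 - Q) *ᵥ x)
    linarith
  have hVW : hsInner V W = nuclearNorm V := by
    rw [hW, hsInner_add_right, hsInner_mul_mul, hsInner_mul_mul, hP, hQ, hPV, hVQ, e₁, hP',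
      Matrix.sub_mul, hPV, Matrix.one_mul, sub_self]
    simp [hsInner]
  have hHcW : hsInner Hc W = nuclearNorm Hc := by
    have c1 : P * Hc * Q = 0 := by
      rw [hHc, ← Matrix.mul_assoc, ← Matrix.mul_assoc, hPP']
      simp
    have c2 : (1 - P) * Hc * (1 - Q) = Hc := by
      rw [hHc, ← Matrix.mul_assoc, ← Matrix.mul_assoc, hP'2, Matrix.mul_assoc, hQ'2]
    rw [hW, hsInner_add_right, hsInner_mul_mul, hsInner_mul_mul, hP, hQ, hP', hQ', c1, c2, e₂]
    simp [hsInner]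
  have d1 : hsInner (X + H) W =
      hsInner V W + hsInner Hc W + hsInner H₀ W + hsInner (X - V) W := by
    simp only [← hsInner_add_left]
    congr 1
    rw [hH]
    abel
  have d2 := hWc.hsInner_le (X + H)
  have d3 := hH₀W (-W) hWc.neg
  have d4 := hWc.neg.hsInner_le (X - V)
  have dneg : ∀ B : Matrix (Fin n₁) (Fin n₂) ℝ, hsInner B (-W) = - hsInner B W := by
    intro B
    simp [hsInner]
  rw [dneg] at d3 d4
  have d5 : nuclearNorm X ≤ nuclearNorm V + nuclearNorm (X - V) := by
    obtain ⟨Y, hY, hYX⟩ := exists_contraction_hsInner_eq X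
    have : hsInner X Y = hsInner V Y + hsInner (X - V) Y := by
      rw [← hsInner_add_left]
      congr 1
      abel
    linarith [hY.hsInner_le V, hY.hsInner_le (X - V)]
  have d6 : nuclearNorm H ≤ 2 * √k * frobeniusNorm H + nuclearNorm Hc := by
    obtain ⟨Y, hY, hYH⟩ := exists_contraction_hsInner_eq H
    have : hsInner H Y = hsInner H₀ Y + hsInner Hc Y := by
      rw [← hsInner_add_left, ← hH]
    linarith [hY.hsInner_le Hc, hH₀W Y hY]
  -- Testing `X + H` against `W` gives `‖V‖_* + ‖Hc‖_* - 2√k ‖H‖_F - ‖X - V‖_* ≤ ‖X + H‖_* ≤ ‖X‖_* ≤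
  -- ‖V‖_* + ‖X - V‖_*`, which bounds `‖Hc‖_*`; `d6` then bounds `‖H‖_*`.
  linarith

theorem bestRankError_nonneg {n₁ n₂ : ℕ} (k : ℕ) (X : Matrix (Fin n₁) (Fin n₂) ℝ) :
    0 ≤ bestRankError k X :=
  Real.sInf_nonneg (by rintro t ⟨V, -, rfl⟩; exact nuclearNorm_nonneg _)

theorem nuclearNorm_le_bestRankError {n₁ n₂ : ℕ} (k : ℕ) (X H : Matrix (Fin n₁) (Fin n₂) ℝ)
    (hXH : nuclearNorm (X + H) ≤ nuclearNorm X) :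
    nuclearNorm H ≤ 4 * √k * frobeniusNorm H + 2 * bestRankError k X := by
  have h : (nuclearNorm H - 4 * √k * frobeniusNorm H) / 2 ≤ bestRankError k X := by
    refine le_csInf ⟨nuclearNorm (X - 0), 0, by simp, rfl⟩ ?_
    rintro t ⟨V, hV, rfl⟩
    have := nuclearNorm_le_of_nuclearNorm_add_le X H V hV hXH
    linarith
  linarith

/-! ### A finite dictionary of matrices of rank one -/

/-- The integer points in the ball of radius `2 √n`. -/
def intNet (n : ℕ) : Finset (Fin n → ℤ) :=
  (Fintype.piFinset fun _ => Finset.Icc (-((4 * n : ℕ) : ℤ)) ((4 * n : ℕ) : ℤ)).filter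
    fun z => ∑ i, z i ^ 2 ≤ 4 * n

theorem mem_intNet {n : ℕ} {z : Fin n → ℤ} : z ∈ intNet n ↔ ∑ i, z i ^ 2 ≤ 4 * n := by
  simp only [intNet, Finset.mem_filter, Fintype.mem_piFinset, Finset.mem_Icc, and_iff_right_iff_imp]
  intro h i
  have h1 : z i ^ 2 ≤ 4 * n :=
    (Finset.single_le_sum (f := fun i => z i ^ 2) (fun i _ => sq_nonneg (z i))
      (Finset.mem_univ i)).trans h
  push_cast
  constructor <;> nlinarith

theorem sum_half_pow_natAbs (N : ℕ) :
    ∑ a ∈ Finset.Icc (-(N : ℤ)) N, (1 / 2 : ℝ) ^ a.natAbs = 3 - 2 * (1 / 2) ^ N := by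
  induction N with
  | zero => norm_num
  | succ N ih =>
    have h : Finset.Icc (-((N + 1 : ℕ) : ℤ)) ((N + 1 : ℕ) : ℤ) =
        insert (-((N + 1 : ℕ) : ℤ)) (insert ((N + 1 : ℕ) : ℤ) (Finset.Icc (-(N : ℤ)) N)) := by
      ext a
      simp only [Finset.mem_insert, Finset.mem_Icc]
      omega
    rw [h, Finset.sum_insert, Finset.sum_insert, ih]
    · simp only [Int.natAbs_neg, Int.natAbs_natCast]
      ring
    · simp
    · simp only [Finset.mem_insert, Finset.mem_Icc]
      omega

/-- Counting by exponential weights: on the net `∑ |zᵢ| ≤ ∑ zᵢ² ≤ 4n`, so `16ⁿ ∏ 2^(-|zᵢ|) ≥ 1`. The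
total weight of the surrounding box factorizes, each coordinate contributing at most `3`. -/
theorem card_intNet_le (n : ℕ) : ((intNet n).card : ℝ) ≤ 48 ^ n := by
  set I := Finset.Icc (-((4 * n : ℕ) : ℤ)) ((4 * n : ℕ) : ℤ)
  have h1 : ((intNet n).card : ℝ) ≤ ∑ z ∈ intNet n, 16 ^ n * ∏ i, (1 / 2 : ℝ) ^ (z i).natAbs := by
    rw [Finset.card_eq_sum_ones, Nat.cast_sum]
    refine Finset.sum_le_sum fun z hz => ?_
    have h2 : ∑ i, (z i).natAbs ≤ 4 * n := by
      have h3 := mem_intNet.mp hz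
      have h4 : ∑ i, ((z i).natAbs : ℤ) ≤ ∑ i, z i ^ 2 :=
        Finset.sum_le_sum fun i _ => by
          rw [← Int.natAbs_sq]
          exact_mod_cast Nat.le_self_pow two_ne_zero _
      have h5 := h4.trans h3
      exact_mod_cast h5
    rw [Finset.prod_pow_eq_pow_sum]
    have h6 : (1 / 2 : ℝ) ^ (4 * n) ≤ (1 / 2 : ℝ) ^ ∑ i, (z i).natAbs :=
      pow_le_pow_of_le_one (by norm_num) (by norm_num) h2
    have h7 : (16 : ℝ) ^ n * (1 / 2 : ℝ) ^ (4 * n) = 1 := by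
      rw [pow_mul, ← mul_pow]
      norm_num
    calc ((1 : ℕ) : ℝ) = (16 : ℝ) ^ n * (1 / 2 : ℝ) ^ (4 * n) := by rw [h7]; simp
      _ ≤ _ := by gcongr
  refine h1.trans ?_
  rw [← Finset.mul_sum]
  have h8 : ∑ z ∈ intNet n, ∏ i, (1 / 2 : ℝ) ^ (z i).natAbs ≤ 3 ^ n := by
    calc ∑ z ∈ intNet n, ∏ i, (1 / 2 : ℝ) ^ (z i).natAbs
        ≤ ∑ z ∈ Fintype.piFinset fun _ : Fin n => I, ∏ i, (1 / 2 : ℝ) ^ (z i).natAbs :=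
          Finset.sum_le_sum_of_subset_of_nonneg (Finset.filter_subset _ _)
            fun z _ _ => by positivity
      _ = ∏ _i : Fin n, ∑ a ∈ I, (1 / 2 : ℝ) ^ a.natAbs :=
          (Finset.prod_univ_sum (fun _ => I) fun _ (a : ℤ) => (1 / 2 : ℝ) ^ a.natAbs).symm
      _ ≤ 3 ^ n := by
          rw [Finset.prod_const, Finset.card_univ, Fintype.card_fin]
          refine pow_le_pow_left₀ (Finset.sum_nonneg fun a _ => by positivity) ?_ _
          rw [sum_half_pow_natAbs]
          have : (0 : ℝ) ≤ (1 / 2) ^ (4 * n) := by positivity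
          linarith
  calc (16 : ℝ) ^ n * ∑ z ∈ intNet n, ∏ i, (1 / 2 : ℝ) ^ (z i).natAbs ≤ 16 ^ n * 3 ^ n := by gcongr
    _ = 48 ^ n := by rw [← mul_pow]; norm_num

/-- Integer vectors, read as real vectors. -/
def castVec {n : ℕ} (z : Fin n → ℤ) : Fin n → ℝ := fun i => z i

theorem castVec_dotProduct_self_le {n : ℕ} {z : Fin n → ℤ} (hz : z ∈ intNet n) :
    castVec z ⬝ᵥ castVec z ≤ 4 * n := by
  have h := mem_intNet.mp hz
  simp only [castVec, dotProduct, ← pow_two]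
  exact_mod_cast h

/-- Rounding the coordinates shows that the ball of radius `√n` lies in the convex hull of
`intNet n`. -/
theorem mem_convexHull_intNet {n : ℕ} {x : Fin n → ℝ} (hx : x ⬝ᵥ x ≤ n) :
    x ∈ convexHull ℝ (castVec '' (intNet n : Set (Fin n → ℤ))) := by
  have h1 : x ∈ convexHull ℝ
      (Set.pi Set.univ fun i => ({(⌊x i⌋ : ℝ), (⌊x i⌋ : ℝ) + 1} : Set ℝ)) := by
    rw [convexHull_pi]
    intro i _
    beta_reduce
    rw [convexHull_pair, segment_eq_Icc (by linarith)]
    exact ⟨Int.floor_le _, (Int.lt_floor_add_one _).le⟩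
  refine convexHull_mono ?_ h1
  intro y hy
  -- A corner of the unit cube around `x` satisfies `|yᵢ - xᵢ| ≤ 1`, hence `yᵢ² ≤ 2xᵢ² + 2(yᵢ - xᵢ)²
  -- ≤ 2xᵢ² + 2`.
  have h2 : ∀ i, ∃ z : ℤ, (z : ℝ) = y i ∧ y i ^ 2 ≤ 2 * x i ^ 2 + 2 := by
    intro i
    have h3 := Int.floor_le (x i)
    have h4 := Int.lt_floor_add_one (x i)
    rcases hy i (Set.mem_univ i) with h | h
    · refine ⟨⌊x i⌋, h.symm, ?_⟩
      rw [h]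
      nlinarith [sq_nonneg (2 * x i - ⌊x i⌋)]
    · rw [Set.mem_singleton_iff] at h
      refine ⟨⌊x i⌋ + 1, by rw [h]; push_cast; rfl, ?_⟩
      rw [h]
      nlinarith [sq_nonneg (2 * x i - (⌊x i⌋ + 1))]
  choose z hz hz2 using h2
  refine ⟨z, ?_, funext hz⟩
  rw [Finset.mem_coe, mem_intNet]
  have h5 : ∑ i, y i ^ 2 ≤ 4 * n := by
    calc ∑ i, y i ^ 2 ≤ ∑ i, (2 * x i ^ 2 + 2) := Finset.sum_le_sum fun i _ => hz2 i
      _ = 2 * (x ⬝ᵥ x) + 2 * n := by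
          rw [Finset.sum_add_distrib, ← Finset.mul_sum]
          simp [dotProduct, pow_two, mul_comm]
      _ ≤ 4 * n := by linarith
  simp only [← hz] at h5
  exact_mod_cast h5

/-- A Euclidean norm is controlled by the inner products with the points of `intNet n`. -/
theorem dotProduct_self_le_of_intNet {n : ℕ} {y : Fin n → ℝ} {β : ℝ}
    (h : ∀ z ∈ intNet n, castVec z ⬝ᵥ y ≤ β * n) : y ⬝ᵥ y ≤ β ^ 2 * n := by
  rcases Nat.eq_zero_or_pos n with rfl | hn
  · simp [dotProduct]
  have hn' : (0 : ℝ) < n := by exact_mod_cast hn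
  rcases (zero_le_dotProduct_self y).eq_or_lt with h0 | h0
  · rw [← h0]; positivity
  -- Rescaled to length `√n`, the vector `y` lies in the hull of the net, hence in every half-space
  -- containing the net.
  set ρ := √(n / (y ⬝ᵥ y)) with hρ
  have hρ2 : ρ ^ 2 = n / (y ⬝ᵥ y) := Real.sq_sqrt (by positivity)
  have hx : (ρ • y) ⬝ᵥ (ρ • y) ≤ n := by
    rw [smul_dotProduct, dotProduct_smul, smul_eq_mul, smul_eq_mul, ← mul_assoc, ← pow_two, hρ2,
      div_mul_cancel₀ _ h0.ne']
  have hconv : Convex ℝ {x : Fin n → ℝ | x ⬝ᵥ y ≤ β * n} :=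
    convex_halfSpace_le ⟨fun a b => add_dotProduct a b y, fun c a => smul_dotProduct c a y⟩ _
  have h1 : (ρ • y) ⬝ᵥ y ≤ β * n := by
    refine convexHull_min ?_ hconv (mem_convexHull_intNet hx)
    rintro _ ⟨z, hz, rfl⟩
    exact h z hz
  rw [smul_dotProduct, smul_eq_mul] at h1
  have h2 : (ρ * (y ⬝ᵥ y)) ^ 2 ≤ (β * n) ^ 2 :=
    pow_le_pow_left₀ (mul_nonneg (Real.sqrt_nonneg _) h0.le) h1 2
  rw [mul_pow, hρ2, mul_pow] at h2
  have h3 : (n : ℝ) / (y ⬝ᵥ y) * (y ⬝ᵥ y) ^ 2 = n * (y ⬝ᵥ y) := by field_simp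
  rw [h3] at h2
  nlinarith

/-- The matrices of rank one that the convex hulls below are taken of. -/
def rankOne {n₁ n₂ : ℕ} (p : (Fin n₁ → ℤ) × (Fin n₂ → ℤ)) : Matrix (Fin n₁) (Fin n₂) ℝ :=
  (√(n₁ : ℝ) * √(n₂ : ℝ))⁻¹ • vecMulVec (castVec p.1) (castVec p.2)

/-- The index set of the dictionary of matrices of rank one. -/
def dictIndex (n₁ n₂ : ℕ) : Finset ((Fin n₁ → ℤ) × (Fin n₂ → ℤ)) := intNet n₁ ×ˢ intNet n₂

theorem card_dictIndex_le (n₁ n₂ : ℕ) : ((dictIndex n₁ n₂).card : ℝ) ≤ 48 ^ (n₁ + n₂) := by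
  rw [dictIndex, Finset.card_product, pow_add, Nat.cast_mul]
  exact mul_le_mul (card_intNet_le _) (card_intNet_le _) (by positivity) (by positivity)

theorem hsInner_rankOne_le {n₁ n₂ : ℕ} {p : (Fin n₁ → ℤ) × (Fin n₂ → ℤ)}
    (hp : p ∈ dictIndex n₁ n₂) : hsInner (rankOne p) (rankOne p) ≤ 16 := by
  obtain ⟨h1, h2⟩ := Finset.mem_product.mp hp
  have h1 := castVec_dotProduct_self_le h1
  have h2 := castVec_dotProduct_self_le h2
  rw [rankOne, hsInner_smul_left, hsInner_smul_right, hsInner_vecMulVec, vecMulVec_mulVec]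
  have h3 := mul_le_mul h1 h2 (zero_le_dotProduct_self _) (by positivity)
  rw [← mul_assoc, ← pow_two, inv_pow, mul_pow, Real.sq_sqrt (by positivity),
    Real.sq_sqrt (by positivity), op_smul_eq_smul, dotProduct_smul, smul_eq_mul]
  rcases (show (0 : ℝ) ≤ n₁ * n₂ by positivity).eq_or_lt with h0 | h0
  · rw [← h0]; norm_num
  · rw [inv_mul_le_iff₀ h0]
    linarith

/-- After scaling by `√n₁` and `√n₂` both vectors lie in the hulls of their nets. The outer product
is bilinear, so the hull can be reached one factor at a time. -/
theorem vecMulVec_mem_convexHull {n₁ n₂ : ℕ} (hn₁ : 0 < n₁) (hn₂ : 0 < n₂) {u : Fin n₁ → ℝ}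
    {v : Fin n₂ → ℝ} (hu : u ⬝ᵥ u ≤ 1) (hv : v ⬝ᵥ v ≤ 1) :
    vecMulVec u v ∈ convexHull ℝ
      (rankOne '' (dictIndex n₁ n₂ : Set ((Fin n₁ → ℤ) × (Fin n₂ → ℤ)))) := by
  set C := convexHull ℝ (rankOne '' (dictIndex n₁ n₂ : Set ((Fin n₁ → ℤ) × (Fin n₂ → ℤ)))) with hC
  have hCc : Convex ℝ C := convex_convexHull _ _
  have hscale : ∀ {n : ℕ} {x : Fin n → ℝ}, x ⬝ᵥ x ≤ 1 →
      (√(n : ℝ) • x) ∈ convexHull ℝ (castVec '' (intNet n : Set (Fin n → ℤ))) := by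
    intro n x hx
    apply mem_convexHull_intNet
    rw [smul_dotProduct, dotProduct_smul, smul_eq_mul, smul_eq_mul, ← mul_assoc,
      Real.mul_self_sqrt (by positivity)]
    exact mul_le_of_le_one_right (by positivity) hx
  set κ := (√(n₁ : ℝ) * √(n₂ : ℝ))⁻¹ with hκ
  have h1 : ∀ z ∈ intNet n₂, ∀ x ∈ convexHull ℝ (castVec '' (intNet n₁ : Set (Fin n₁ → ℤ))),
      κ • vecMulVec x (castVec z) ∈ C := by
    intro z hz x hx
    have hlin : IsLinearMap ℝ fun x : Fin n₁ → ℝ => κ • vecMulVec x (castVec z) :=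
      ⟨fun a b => by rw [add_vecMulVec, smul_add],
        fun c a => by rw [smul_vecMulVec, smul_comm]⟩
    refine convexHull_min ?_ (hCc.is_linear_preimage hlin) hx
    rintro _ ⟨y, hy, rfl⟩
    exact subset_convexHull ℝ _ ⟨(y, z), Finset.mem_product.mpr ⟨hy, hz⟩, rfl⟩
  have h2 : ∀ x ∈ convexHull ℝ (castVec '' (intNet n₁ : Set (Fin n₁ → ℤ))),
      ∀ y ∈ convexHull ℝ (castVec '' (intNet n₂ : Set (Fin n₂ → ℤ))),
      κ • vecMulVec x y ∈ C := by
    intro x hx y hy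
    have hlin : IsLinearMap ℝ fun y : Fin n₂ → ℝ => κ • vecMulVec x y :=
      ⟨fun a b => by rw [vecMulVec_add, smul_add],
        fun c a => by rw [vecMulVec_smul, smul_comm]⟩
    refine convexHull_min ?_ (hCc.is_linear_preimage hlin) hy
    rintro _ ⟨z, hz, rfl⟩
    exact h1 z hz x hx
  have h3 := h2 _ (hscale hu) _ (hscale hv)
  have e1 : √(n₁ : ℝ) ≠ 0 := by positivity
  have e2 : √(n₂ : ℝ) ≠ 0 := by positivity
  rwa [smul_vecMulVec, vecMulVec_smul, smul_smul, smul_smul, hκ, mul_assoc,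
    inv_mul_cancel₀ (by positivity), one_smul] at h3

/-- The singular value decomposition, divided by the nuclear norm, is a convex combination of outer
products of vectors of length at most one. -/
theorem exists_mem_convexHull_eq_smul {n₁ n₂ : ℕ} (hn₁ : 0 < n₁) (hn₂ : 0 < n₂)
    (H : Matrix (Fin n₁) (Fin n₂) ℝ) :
    ∃ x ∈ convexHull ℝ (rankOne '' (dictIndex n₁ n₂ : Set ((Fin n₁ → ℤ) × (Fin n₂ → ℤ)))),
      H = nuclearNorm H • x := by
  obtain ⟨σ, u, v, hσ, hsum, -, hu, hv, hA⟩ := exists_svd H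
  rcases (nuclearNorm_nonneg H).eq_or_lt with h0 | h0
  · refine ⟨vecMulVec 0 0, vecMulVec_mem_convexHull hn₁ hn₂ (by simp) (by simp), ?_⟩
    have h1 : ∀ i, σ i = 0 := by
      intro i
      rw [← h0] at hsum
      exact (Finset.sum_eq_zero_iff_of_nonneg fun i _ => hσ i).mp hsum i (Finset.mem_univ i)
    rw [← h0, hA]
    simp [h1]
  · refine ⟨∑ i, (σ i / nuclearNorm H) • vecMulVec (u i) (v i), ?_, ?_⟩
    · refine (convex_convexHull ℝ _).sum_mem (fun i _ => div_nonneg (hσ i) h0.le) ?_ fun i _ => ?_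
      · rw [← Finset.sum_div, hsum, div_self h0.ne']
      · refine vecMulVec_mem_convexHull hn₁ hn₂ ?_ ?_
        · rw [hu]; split_ifs <;> norm_num
        · rw [hv, if_pos rfl]
    · conv_lhs => rw [hA]
      rw [Finset.smul_sum]
      refine Finset.sum_congr rfl fun i _ => ?_
      rw [smul_smul, mul_div_cancel₀ _ h0.ne']

/-! ### The empirical method of Maurey for quadratic forms -/

section Maurey

variable {E : Type*} [AddCommGroup E] [Module ℝ E] (B : E →ₗ[ℝ] E →ₗ[ℝ] ℝ) {s : Set E} {x : E}
  {β : ℝ}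

/-- If `y` is random in `s` with mean `x`, then the mean of `B (G + y) (G + y)` is `B (G + x) (G +
x) + 𝔼 B y y - B x x`, so some `y` does at least as well. Without probability: otherwise a linear
functional would exceed its value at `x` on all of `s`, hence at `x` itself. Positivity of `B` plays
no role. -/
theorem exists_mem_add_le_of_mem_convexHull (hx : x ∈ convexHull ℝ s) (hβ : ∀ y ∈ s, B y y ≤ β)
    (G : E) : ∃ y ∈ s, B (G + y) (G + y) ≤ B (G + x) (G + x) + (β - B x x) := by
  by_contra! h
  have hsub : s ⊆ {y | (B G + B.flip G) x < (B G + B.flip G) y} := by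
    intro y hy
    have h1 := h y hy
    have h2 := hβ y hy
    simp only [map_add, LinearMap.add_apply, LinearMap.flip_apply, Set.mem_ofPred_eq] at h1 ⊢
    linarith
  have h3 := convexHull_min hsub (convex_halfSpace_gt (B G + B.flip G).isLinear _) hx
  rw [Set.mem_ofPred_eq] at h3
  exact lt_irrefl _ h3

theorem exists_sum_le_of_mem_convexHull (hx : x ∈ convexHull ℝ s) (hβ : ∀ y ∈ s, B y y ≤ β)
    (N : ℕ) (G : E) : ∃ f : Fin N → E, (∀ t, f t ∈ s) ∧
      B (G + ∑ t, f t) (G + ∑ t, f t) ≤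
        B (G + (N : ℝ) • x) (G + (N : ℝ) • x) + N * (β - B x x) := by
  induction N generalizing G with
  | zero => exact ⟨Fin.elim0, fun t => t.elim0, by simp⟩
  | succ N ih =>
    -- One copy of `x` is traded for a point of `s` while the other `N` copies are kept in the base
    -- point.
    obtain ⟨y, hy, h1⟩ := exists_mem_add_le_of_mem_convexHull B hx hβ (G + (N : ℝ) • x)
    obtain ⟨f, hf, h2⟩ := ih (G + y)
    refine ⟨Fin.cons y f, fun t => ?_, ?_⟩
    · refine Fin.cases ?_ (fun t => ?_) t
      · simpa using hy
      · simpa using hf t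
    · rw [Fin.sum_univ_succ]
      simp only [Fin.cons_zero, Fin.cons_succ]
      rw [← add_assoc]
      refine h2.trans ?_
      have e1 : G + y + (N : ℝ) • x = G + (N : ℝ) • x + y := by abel
      have e2 : G + ((N + 1 : ℕ) : ℝ) • x = G + (N : ℝ) • x + x := by
        push_cast
        rw [add_smul, one_smul, add_assoc]
      rw [e1, e2]
      push_cast
      linarith

/-- A quadratic form that is nonnegative on all sums of `N` points of `s` is nearly nonnegative on
the convex hull of `s`. -/
theorem nonneg_of_mem_convexHull (hx : x ∈ convexHull ℝ s) (hβ : ∀ y ∈ s, B y y ≤ β) {N : ℕ}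
    (hN : 0 < N) (h : ∀ f : Fin N → E, (∀ t, f t ∈ s) → 0 ≤ B (∑ t, f t) (∑ t, f t)) :
    0 ≤ ((N : ℝ) - 1) * B x x + β := by
  obtain ⟨f, hf, h1⟩ := exists_sum_le_of_mem_convexHull B hx hβ N 0
  have h2 := h f hf
  simp only [zero_add, map_smul, LinearMap.smul_apply, smul_eq_mul] at h1
  have hN' : (0 : ℝ) < N := by exact_mod_cast hN
  -- With `G = 0` the bound reads `N² B x x + N (β - B x x)`.
  have h3 : 0 ≤ (N : ℝ) * (((N : ℝ) - 1) * B x x + β) := by nlinarith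
  exact nonneg_of_mul_nonneg_right h3 hN'

end Maurey

/-! ### Local averages that invert powers of the difference matrix -/

/-- The Schur test. -/
theorem mulVec_dotProduct_self_le {l m : ℕ} {M : Matrix (Fin l) (Fin m) ℝ} (h0 : ∀ i j, 0 ≤ M i j)
    {ρ κ : ℝ} (hρ : 0 ≤ ρ) (hrow : ∀ i, ∑ j, M i j ≤ ρ) (hcol : ∀ j, ∑ i, M i j ≤ κ)
    (x : Fin m → ℝ) : (M *ᵥ x) ⬝ᵥ (M *ᵥ x) ≤ ρ * κ * (x ⬝ᵥ x) := by
  have h1 : ∀ i, (M *ᵥ x) i * (M *ᵥ x) i ≤ ρ * ∑ j, M i j * x j ^ 2 := by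
    intro i
    have h2 : (∑ j, M i j * x j) ^ 2 ≤ (∑ j, M i j) * ∑ j, M i j * x j ^ 2 :=
      Finset.sum_sq_le_sum_mul_sum_of_sq_le_mul _ (fun j _ => h0 i j)
        (fun j _ => mul_nonneg (h0 i j) (sq_nonneg _)) (fun j _ => le_of_eq (by ring))
    rw [← pow_two]
    exact h2.trans (mul_le_mul_of_nonneg_right (hrow i)
      (Finset.sum_nonneg fun j _ => mul_nonneg (h0 i j) (sq_nonneg _)))
  calc (M *ᵥ x) ⬝ᵥ (M *ᵥ x) ≤ ∑ i, ρ * ∑ j, M i j * x j ^ 2 := Finset.sum_le_sum fun i _ => h1 i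
    _ = ρ * ∑ j, (∑ i, M i j) * x j ^ 2 := by
        rw [← Finset.mul_sum, Finset.sum_comm]
        simp only [Finset.sum_mul]
    _ ≤ ρ * ∑ j, κ * x j ^ 2 := by
        gcongr with j
        exact hcol j
    _ = ρ * κ * (x ⬝ᵥ x) := by
        rw [← Finset.mul_sum, mul_assoc]
        simp only [dotProduct, pow_two]

/-- The matrix of the shift by one. -/
def shiftMatrix (m : ℕ) : Matrix (Fin m) (Fin m) ℝ := 1 - diffMatrix m

theorem shiftMatrix_pow_apply {m : ℕ} (k : ℕ) (i j : Fin m) :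
    (shiftMatrix m ^ k) i j = if (i : ℕ) = j + k then 1 else 0 := by
  induction k generalizing i j with
  | zero => simp [one_apply, Fin.ext_iff]
  | succ k ih =>
    have h1 : ∀ a b : Fin m, shiftMatrix m a b = if (a : ℕ) = b + 1 then 1 else 0 := by
      intro a b
      simp only [shiftMatrix, diffMatrix, Matrix.sub_apply, one_apply, of_apply, Fin.ext_iff]
      split_ifs <;> first | omega | norm_num
    rw [pow_succ, mul_apply]
    simp only [ih, h1]
    by_cases hj : (j : ℕ) + 1 < m
    · rw [Finset.sum_eq_single ⟨j + 1, hj⟩]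
      · simp only [if_true, mul_one]
        congr 1
        rw [eq_iff_iff]
        omega
      · intro b _ hb
        have : (b : ℕ) ≠ j + 1 := fun h => hb (Fin.ext h)
        simp [this]
      · simp
    · rw [if_neg (by omega)]
      refine Finset.sum_eq_zero fun b _ => ?_
      rw [if_neg (by omega : ¬ (b : ℕ) = j + 1), mul_zero]

theorem sum_ite_eq_add_le {m : ℕ} (k : ℕ) (i : Fin m) :
    ∑ j : Fin m, (if (i : ℕ) = j + k then (1 : ℝ) else 0) = if k ≤ (i : ℕ) then 1 else 0 := by
  by_cases h : k ≤ (i : ℕ)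
  · rw [if_pos h, Finset.sum_eq_single ⟨i - k, by omega⟩]
    · rw [if_pos (by simp only; omega)]
    · intro b _ hb
      rw [if_neg]
      intro h'
      apply hb
      ext
      simp only
      omega
    · simp
  · rw [if_neg h]
    exact Finset.sum_eq_zero fun j _ => by rw [if_neg (by omega)]

theorem sum_ite_add_eq_le {m : ℕ} (k : ℕ) (j : Fin m) :
    ∑ i : Fin m, (if (i : ℕ) = j + k then (1 : ℝ) else 0) ≤ 1 := by
  by_cases h : (j : ℕ) + k < m
  · rw [Finset.sum_eq_single ⟨j + k, h⟩]
    · simp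
    · intro b _ hb
      exact if_neg fun h' => hb (Fin.ext h')
    · simp
  · rw [Finset.sum_eq_zero fun i _ => by rw [if_neg (by omega)]]
    exact zero_le_one

theorem isContraction_shiftMatrix_pow (m k : ℕ) : IsContraction (shiftMatrix m ^ k) := by
  intro x
  have h := mulVec_dotProduct_self_le (M := shiftMatrix m ^ k) (ρ := 1) (κ := 1)
    (fun i j => by rw [shiftMatrix_pow_apply]; split_ifs <;> norm_num) zero_le_one
    (fun i => by
      simp only [shiftMatrix_pow_apply]
      rw [sum_ite_eq_add_le]
      split_ifs <;> norm_num)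
    (fun j => by
      simp only [shiftMatrix_pow_apply]
      exact sum_ite_add_eq_le k j) x
  simpa using h

/-- The sum over a sliding window of length `h`. -/
def windowMatrix (m h : ℕ) : Matrix (Fin m) (Fin m) ℝ := ∑ k ∈ Finset.range h, shiftMatrix m ^ k

/-- A window sum of a first difference telescopes to a difference of lag `h`, and all the matrices
are polynomials in the shift. -/
theorem windowMatrix_pow_mul_diffMatrix_pow (m h r : ℕ) :
    windowMatrix m h ^ r * diffMatrix m ^ r = (1 - shiftMatrix m ^ h) ^ r := by
  have hD : diffMatrix m = 1 - shiftMatrix m := by simp [shiftMatrix]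
  have h1 : windowMatrix m h * (1 - shiftMatrix m) = 1 - shiftMatrix m ^ h :=
    geom_sum_mul_neg _ _
  have h2 : (1 - shiftMatrix m) * windowMatrix m h = 1 - shiftMatrix m ^ h :=
    mul_neg_geom_sum _ _
  have hc : Commute (windowMatrix m h) (1 - shiftMatrix m) := h1.trans h2.symm
  rw [hD, ← hc.mul_pow, h1]

/-- Each factor satisfies `|y - z|² ≤ 2|y|² + 2|z|² ≤ 4|y|²`. The bound does not grow with the lag,
which is the source of the gain once the windows are normalized. -/
theorem one_sub_shiftMatrix_pow_mulVec_le (m h r : ℕ) (x : Fin m → ℝ) :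
    ((1 - shiftMatrix m ^ h) ^ r *ᵥ x) ⬝ᵥ ((1 - shiftMatrix m ^ h) ^ r *ᵥ x) ≤
      4 ^ r * (x ⬝ᵥ x) := by
  induction r with
  | zero => simp
  | succ r ih =>
    rw [pow_succ', ← mulVec_mulVec]
    set y := (1 - shiftMatrix m ^ h) ^ r *ᵥ x
    set z := shiftMatrix m ^ h *ᵥ y with hz
    have h1 : z ⬝ᵥ z ≤ y ⬝ᵥ y := isContraction_shiftMatrix_pow m h y
    have h2 : (1 - shiftMatrix m ^ h) *ᵥ y = y - z := by rw [sub_mulVec, one_mulVec]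
    have h3 := zero_le_dotProduct_self (y + z)
    rw [h2]
    simp only [add_dotProduct, dotProduct_add, sub_dotProduct, dotProduct_sub,
      dotProduct_comm z y] at h3 ⊢
    rw [pow_succ']
    linarith

/-- `w` takes values in `[0, a]`, is supported in `[p, q]` and has the sum `b`. -/
structure IsBump {m : ℕ} (w : Fin m → ℝ) (a : ℝ) (p q : ℕ) (b : ℝ) : Prop where
  nonneg : ∀ i, 0 ≤ w i
  le : ∀ i, w i ≤ a
  left : ∀ i : Fin m, w i ≠ 0 → p ≤ i
  right : ∀ i : Fin m, w i ≠ 0 → (i : ℕ) ≤ q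
  sum : ∑ i, w i = b

theorem vecMul_shiftMatrix_pow {m : ℕ} (w : Fin m → ℝ) (k : ℕ) (j : Fin m) :
    (w ᵥ* shiftMatrix m ^ k) j = if h : (j : ℕ) + k < m then w ⟨j + k, h⟩ else 0 := by
  simp only [vecMul, dotProduct, shiftMatrix_pow_apply]
  split_ifs with h
  · rw [Finset.sum_eq_single ⟨j + k, h⟩]
    · simp
    · intro b _ hb
      rw [if_neg fun h' => hb (Fin.ext h'), mul_zero]
    · simp
  · refine Finset.sum_eq_zero fun i _ => ?_
    rw [if_neg (by omega), mul_zero]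

/-- A window of length `h + 1` spreads each entry over its own place and the `h` places to its left;
`h ≤ p` keeps mass from falling off the left end. -/
theorem IsBump.vecMul_windowMatrix {m : ℕ} {w : Fin m → ℝ} {a b : ℝ} {p q h : ℕ}
    (hw : IsBump w a p q b) (ha : 0 ≤ a) (hp : h ≤ p) :
    IsBump (w ᵥ* windowMatrix m (h + 1)) ((h + 1) * a) (p - h) q ((h + 1) * b) := by
  have hval : ∀ j, (w ᵥ* windowMatrix m (h + 1)) j =
      ∑ k ∈ Finset.range (h + 1), (w ᵥ* shiftMatrix m ^ k) j := by
    intro j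
    rw [windowMatrix, vecMul_sum, Finset.sum_apply]
  have h0 : ∀ k j, 0 ≤ (w ᵥ* shiftMatrix m ^ k) j := by
    intro k j
    rw [vecMul_shiftMatrix_pow]
    split_ifs
    · exact hw.nonneg _
    · exact le_rfl
  have hsupp : ∀ j, (w ᵥ* windowMatrix m (h + 1)) j ≠ 0 → p - h ≤ (j : ℕ) ∧ (j : ℕ) ≤ q := by
    intro j hj
    rw [hval] at hj
    obtain ⟨k, hk, hkj⟩ := Finset.exists_ne_zero_of_sum_ne_zero hj
    rw [Finset.mem_range] at hk
    rw [vecMul_shiftMatrix_pow] at hkj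
    split_ifs at hkj with h1
    · have h2 := hw.left _ hkj
      have h3 := hw.right _ hkj
      simp only at h2 h3
      omega
    · exact absurd rfl hkj
  refine ⟨fun j => ?_, fun j => ?_, fun j hj => (hsupp j hj).1, fun j hj => (hsupp j hj).2, ?_⟩
  · rw [hval]
    exact Finset.sum_nonneg fun k _ => h0 k j
  · rw [hval]
    calc ∑ k ∈ Finset.range (h + 1), (w ᵥ* shiftMatrix m ^ k) j
        ≤ ∑ k ∈ Finset.range (h + 1), a := by
          refine Finset.sum_le_sum fun k _ => ?_
          rw [vecMul_shiftMatrix_pow]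
          split_ifs
          · exact hw.le _
          · exact ha
      _ = (h + 1) * a := by simp
  · simp only [hval]
    rw [Finset.sum_comm]
    have h1 : ∀ k ∈ Finset.range (h + 1), ∑ j, (w ᵥ* shiftMatrix m ^ k) j = b := by
      intro k hk
      rw [Finset.mem_range] at hk
      simp only [vecMul, dotProduct, shiftMatrix_pow_apply]
      rw [Finset.sum_comm, ← hw.sum]
      refine Finset.sum_congr rfl fun i _ => ?_
      rw [← Finset.mul_sum, sum_ite_eq_add_le]
      by_cases hi : w i = 0
      · simp [hi]
      · have := hw.left i hi
        rw [if_pos (by omega), mul_one]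
    rw [Finset.sum_congr rfl h1]
    simp

theorem IsBump.vecMul_windowMatrix_pow {m : ℕ} {w : Fin m → ℝ} {a b : ℝ} {p q h : ℕ} (r : ℕ)
    (hw : IsBump w a p q b) (ha : 0 ≤ a) (hp : r * h ≤ p) :
    IsBump (w ᵥ* windowMatrix m (h + 1) ^ r) ((h + 1) ^ r * a) (p - r * h) q ((h + 1) ^ r * b) := by
  induction r with
  | zero => simpa using hw
  | succ r ih =>
    have h1 : r * h + h ≤ p := by rw [← Nat.succ_mul]; exact hp
    have h2 := (ih (by omega)).vecMul_windowMatrix (h := h) (by positivity) (by omega)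
    rw [vecMul_vecMul, ← pow_succ, ← mul_assoc, ← mul_assoc, ← pow_succ'] at h2
    rwa [show p - (r + 1) * h = p - r * h - h by rw [Nat.succ_mul]; omega]

/-- `ℓ` averages over disjoint blocks, of square sum about one, that annihilate `r`-fold differences
up to `(ℓ / m) ^ r`. -/
theorem exists_block_averages (r : ℕ) {l m : ℕ} (hl : 0 < l) (hlm : l ≤ m) :
    ∃ T : Matrix (Fin l) (Fin m) ℝ,
      (∀ j j' i, T j i ≠ 0 → T j' i ≠ 0 → j = j') ∧
      (∀ j, 1 / ((r : ℝ) + 1) ≤ ∑ i, T j i ^ 2) ∧ (∀ j, ∑ i, T j i ^ 2 ≤ 1) ∧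
      IsContraction T ∧
      ∀ u, (T *ᵥ (diffMatrix m ^ r *ᵥ u)) ⬝ᵥ (T *ᵥ (diffMatrix m ^ r *ᵥ u)) ≤
        ((4 * ((r : ℝ) + 1) * (l / m)) ^ r) ^ 2 * (u ⬝ᵥ u) := by
  set s := m / l with hs
  have hs1 : 1 ≤ s := (Nat.one_le_div_iff hl).mpr hlm
  have hsl : s * l ≤ m := Nat.div_mul_le_self m l
  -- A window of length `h + 1`, widened `r` times by `h`, occupies `(r + 1) h + 1` places and so
  -- fits in a block of length `s`.
  set h := (s - 1) / (r + 1) with hh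
  have hhs : (r + 1) * h + 1 ≤ s := by
    have := Nat.mul_div_le (s - 1) (r + 1)
    rw [← hh] at this
    omega
  clear_value h
  set H : ℝ := (h : ℝ) + 1 with hH
  have hH0 : 0 < H := by positivity
  -- the indicators of the windows
  set G : Matrix (Fin l) (Fin m) ℝ := of fun j i =>
    if s * j + r * h ≤ (i : ℕ) ∧ (i : ℕ) ≤ s * j + (r + 1) * h then 1 else 0 with hG
  have hfit : ∀ j : Fin l, s * j + (r + 1) * h < m := by
    intro j
    have h1 : s * (j + 1) ≤ s * l := Nat.mul_le_mul_left s j.2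
    have h2 : s * (j + 1) = s * j + s := by ring
    omega
  have hfit' : ∀ j : Fin l, s * j + r * h < m := fun j =>
    (Nat.add_le_add_left (Nat.mul_le_mul_right h (Nat.le_succ r)) _).trans_lt (hfit j)
  have hexp : (r + 1) * h = r * h + h := by ring
  have hGsum : ∀ j, ∑ i, G j i = H := by
    intro j
    simp only [hG, of_apply, Finset.sum_boole]
    have : (Finset.univ.filter fun i : Fin m =>
        s * j + r * h ≤ (i : ℕ) ∧ (i : ℕ) ≤ s * j + (r + 1) * h).card = h + 1 := by
      have h1 := Fin.card_Icc (⟨s * j + r * h, hfit' j⟩ : Fin m)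
        ⟨s * j + (r + 1) * h, hfit j⟩
      have h2 : (Finset.univ.filter fun i : Fin m =>
        s * j + r * h ≤ (i : ℕ) ∧ (i : ℕ) ≤ s * j + (r + 1) * h) =
        Finset.Icc ⟨s * j + r * h, hfit' j⟩ ⟨s * j + (r + 1) * h, hfit j⟩ := by
        ext i
        simp [Fin.le_def]
      rw [h2, h1]
      change s * j + (r + 1) * h + 1 - (s * j + r * h) = h + 1
      rw [hexp]
      omega
    rw [this, hH]
    push_cast
    rfl
  have hbump : ∀ j, IsBump (G j) 1 (s * j + r * h) (s * j + (r + 1) * h) H := by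
    intro j
    refine ⟨fun i => ?_, fun i => ?_, fun i hi => ?_, fun i hi => ?_, hGsum j⟩
    · simp only [hG, of_apply]; split_ifs <;> norm_num
    · simp only [hG, of_apply]; split_ifs <;> norm_num
    all_goals
      simp only [hG, of_apply] at hi
      split_ifs at hi with h1
      · first | exact h1.1 | exact h1.2
      · exact absurd rfl hi
  have hblock : ∀ (j : Fin l) (i : ℕ), s * j ≤ i → i ≤ s * j + (r + 1) * h → i / s = j := by
    intro j i h1 h2
    rw [Nat.div_eq_iff (by omega)]
    constructor
    · rw [mul_comm]; exact h1
    · rw [mul_comm]; omega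
  -- Before scaling, the entries are at most `H^r` and the row sums are `H^(r+1)`. Afterwards they
  -- are at most `1/√H` and equal to `√H`, which gives square sums at most one and, by the Schur
  -- test, a contraction.
  set κ : ℝ := (H ^ r * √H)⁻¹ with hκ
  have hκ0 : 0 < κ := by positivity
  have hsq : √H * √H = H := Real.mul_self_sqrt hH0.le
  have hsq0 : 0 < √H := Real.sqrt_pos.mpr hH0
  set T : Matrix (Fin l) (Fin m) ℝ := κ • (G * windowMatrix m (h + 1) ^ r) with hT
  have hrowbump : ∀ j, IsBump (fun i => (G * windowMatrix m (h + 1) ^ r) j i) (H ^ r) (s * j)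
      (s * j + (r + 1) * h) (H ^ r * H) := by
    intro j
    have h1 := (hbump j).vecMul_windowMatrix_pow (h := h) r zero_le_one (by omega)
    rw [mul_one, Nat.add_sub_cancel] at h1
    have h2 : (fun i => (G * windowMatrix m (h + 1) ^ r) j i) =
        G j ᵥ* windowMatrix m (h + 1) ^ r := by
      ext i
      rw [mul_apply_eq_vecMul]
    rw [h2]
    exact h1
  have hT0 : ∀ j i, 0 ≤ T j i := fun j i => mul_nonneg hκ0.le ((hrowbump j).nonneg i)
  have hTle : ∀ j i, T j i ≤ (√H)⁻¹ := by
    intro j i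
    calc T j i = κ * (G * windowMatrix m (h + 1) ^ r) j i := rfl
      _ ≤ κ * H ^ r := mul_le_mul_of_nonneg_left ((hrowbump j).le i) hκ0.le
      _ = (√H)⁻¹ := by rw [hκ]; field_simp
  have hTsum : ∀ j, ∑ i, T j i = √H := by
    intro j
    calc ∑ i, T j i = κ * ∑ i, (G * windowMatrix m (h + 1) ^ r) j i := by
          rw [Finset.mul_sum]; rfl
      _ = κ * (H ^ r * H) := by rw [(hrowbump j).sum]
      _ = κ * (H ^ r * (√H * √H)) := by rw [hsq]
      _ = √H := by rw [hκ]; field_simp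
  have hTsupp : ∀ j i, T j i ≠ 0 → s * (j : ℕ) ≤ i ∧ (i : ℕ) ≤ s * j + (r + 1) * h := by
    intro j i hji
    have h1 : (G * windowMatrix m (h + 1) ^ r) j i ≠ 0 := by
      intro h2
      apply hji
      rw [hT, Matrix.smul_apply, h2, smul_zero]
    exact ⟨(hrowbump j).left i h1, (hrowbump j).right i h1⟩
  have hTblock : ∀ j i, T j i ≠ 0 → (i : ℕ) / s = j := fun j i hji =>
    hblock j i (hTsupp j i hji).1 (hTsupp j i hji).2
  refine ⟨T, fun j j' i h1 h2 => Fin.ext ((hTblock j i h1).symm.trans (hTblock j' i h2)),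
    fun j => ?_, fun j => ?_, fun x => ?_, fun u => ?_⟩
  -- The row sum `√H` is spread over at most `(r + 1) H` entries, so Cauchy–Schwarz bounds the
  -- square sum below.
  · set F := Finset.univ.filter fun i : Fin m => T j i ≠ 0 with hF
    have hcard : (F.card : ℝ) ≤ (r + 1) * H := by
      have h1 : F.card ≤ (Finset.Icc (s * j) (s * (j : ℕ) + (r + 1) * h)).card := by
        apply Finset.card_le_card_of_injOn (fun i : Fin m => (i : ℕ))
        · intro i hi
          have := hTsupp j i (by simpa [hF] using hi)
          simpa using this
        · intro a _ b _ hab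
          exact Fin.ext hab
      rw [Nat.card_Icc] at h1
      have h2 : F.card ≤ (r + 1) * (h + 1) := by
        have : (r + 1) * (h + 1) = (r + 1) * h + r + 1 := by ring
        omega
      calc (F.card : ℝ) ≤ ((r + 1) * (h + 1) : ℕ) := by exact_mod_cast h2
        _ = (r + 1) * H := by push_cast; rfl
    have h3 : ∑ i ∈ F, T j i = √H := by
      rw [← hTsum j]
      exact Finset.sum_filter_ne_zero _
    have h4 : (∑ i ∈ F, T j i) ^ 2 ≤ F.card * ∑ i ∈ F, T j i ^ 2 := sq_sum_le_card_mul_sum_sq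
    have h5 : ∑ i ∈ F, T j i ^ 2 ≤ ∑ i, T j i ^ 2 :=
      Finset.sum_le_sum_of_subset_of_nonneg (Finset.filter_subset _ _) fun i _ _ => sq_nonneg _
    rw [h3, pow_two, hsq] at h4
    have h6 : H ≤ (r + 1) * H * ∑ i, T j i ^ 2 :=
      h4.trans (mul_le_mul hcard h5 (Finset.sum_nonneg fun i _ => sq_nonneg _) (by positivity))
    rw [div_le_iff₀ (by positivity)]
    have h7 : H * 1 ≤ H * ((∑ i, T j i ^ 2) * (r + 1)) := by linarith
    exact le_of_mul_le_mul_left h7 hH0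
  · calc ∑ i, T j i ^ 2 ≤ ∑ i, (√H)⁻¹ * T j i := by
          refine Finset.sum_le_sum fun i _ => ?_
          rw [pow_two]
          exact mul_le_mul_of_nonneg_right (hTle j i) (hT0 j i)
      _ = 1 := by rw [← Finset.mul_sum, hTsum, inv_mul_cancel₀ hsq0.ne']
  · have hcol : ∀ i, ∑ j, T j i ≤ (√H)⁻¹ := by
      intro i
      by_cases hex : ∃ j, T j i ≠ 0
      · obtain ⟨j, hj⟩ := hex
        rw [Finset.sum_eq_single j]
        · exact hTle j i
        · intro j' _ hj'
          by_contra h1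
          exact hj' (Fin.ext ((hTblock j' i h1).symm.trans (hTblock j i hj)))
        · simp
      · push Not at hex
        rw [Finset.sum_eq_zero fun j _ => hex j]
        positivity
    have := mulVec_dotProduct_self_le hT0 hsq0.le (fun j => (hTsum j).le) hcol x
    rwa [mul_inv_cancel₀ hsq0.ne', one_mul] at this
  · have e1 : T *ᵥ (diffMatrix m ^ r *ᵥ u) =
        κ • (G *ᵥ ((1 - shiftMatrix m ^ (h + 1)) ^ r *ᵥ u)) := by
      rw [hT, smul_mulVec, mulVec_mulVec, mulVec_mulVec, Matrix.mul_assoc,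
        windowMatrix_pow_mul_diffMatrix_pow]
    rw [e1, smul_dotProduct, dotProduct_smul, smul_eq_mul, smul_eq_mul]
    set y := (1 - shiftMatrix m ^ (h + 1)) ^ r *ᵥ u
    have hGcol : ∀ i, ∑ j, G j i ≤ 1 := by
      intro i
      by_cases hex : ∃ j, G j i ≠ 0
      · obtain ⟨j, hj⟩ := hex
        rw [Finset.sum_eq_single j]
        · exact (hbump j).le i
        · intro j' _ hj'
          by_contra h1
          have a1 := hblock j i (by have := (hbump j).left i hj; omega) ((hbump j).right i hj)
          have a2 := hblock j' i (by have := (hbump j').left i h1; omega) ((hbump j').right i h1)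
          exact hj' (Fin.ext (a2.symm.trans a1))
        · simp
      · push Not at hex
        rw [Finset.sum_eq_zero fun j _ => hex j]
        exact zero_le_one
    have e2 := mulVec_dotProduct_self_le (fun j i => (hbump j).nonneg i) hH0.le
      (fun j => (hGsum j).le) hGcol y
    have e3 := one_sub_shiftMatrix_pow_mulVec_le m (h + 1) r u
    -- Both roundings lose a bounded factor: `s ≤ (r + 1) H` and `m ≤ 2 ℓ s`.
    have e4 : (2 / H) ≤ 4 * ((r : ℝ) + 1) * (l / m) := by
      have hm0 : (0 : ℝ) < m := by exact_mod_cast hl.trans_le hlm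
      have hl0 : (0 : ℝ) < l := by exact_mod_cast hl
      have f1 : s ≤ (r + 1) * (h + 1) := by
        have := Nat.lt_mul_div_succ (s - 1) (by omega : 0 < r + 1)
        rw [← hh] at this
        omega
      have f2 : m ≤ 2 * l * s := by
        have := Nat.lt_mul_div_succ m hl
        rw [← hs] at this
        have : l * (s + 1) = l * s + l := by ring
        have : l * 1 ≤ l * s := Nat.mul_le_mul_left l hs1
        have : 2 * l * s = 2 * (l * s) := by ring
        omega
      have f3 : m ≤ 2 * l * ((r + 1) * (h + 1)) := f2.trans (Nat.mul_le_mul_left _ f1)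
      have f4 : (m : ℝ) ≤ 2 * l * ((r + 1) * H) := by
        rw [hH]
        exact_mod_cast f3
      rw [mul_div_assoc', div_le_div_iff₀ hH0 hm0]
      linarith
    have e5 : κ * κ * H * 4 ^ r = ((2 / H) ^ r) ^ 2 := by
      have : κ * κ * H = ((H ^ r) ^ 2)⁻¹ := by
        rw [hκ, ← mul_inv, mul_mul_mul_comm, hsq, ← pow_two]
        field_simp
      rw [this, div_pow, div_pow, ← pow_mul 2 r 2, mul_comm r 2, pow_mul]
      norm_num
      ring
    have hu := zero_le_dotProduct_self u
    calc κ * (κ * ((G *ᵥ y) ⬝ᵥ (G *ᵥ y))) = κ * κ * ((G *ᵥ y) ⬝ᵥ (G *ᵥ y)) := by ring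
      _ ≤ κ * κ * (H * 1 * (4 ^ r * (u ⬝ᵥ u))) := by
          refine mul_le_mul_of_nonneg_left (e2.trans ?_) (by positivity)
          exact mul_le_mul_of_nonneg_left e3 (by positivity)
      _ = κ * κ * H * 4 ^ r * (u ⬝ᵥ u) := by ring
      _ = ((2 / H) ^ r) ^ 2 * (u ⬝ᵥ u) := by rw [e5]
      _ ≤ _ := by gcongr

/-! ### Sub-Gaussian random variables -/

section Probability

open MeasureTheory ProbabilityTheory Real
open scoped NNReal ENNReal

/-- Isolates the linear term, which integrates to zero for a centred variable. -/
theorem exp_le_add_exp_sq (x : ℝ) : exp x ≤ x + exp (x ^ 2) := by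
  have h1 := add_one_le_exp (x ^ 2)
  rcases le_or_gt |x| 1 with h | h
  · have h2 := (abs_le.mp (abs_exp_sub_one_sub_id_le h)).2
    linarith
  · rcases lt_abs.mp h with h2 | h2
    · have : exp x ≤ exp (x ^ 2) := exp_le_exp.mpr (by nlinarith)
      linarith
    · have : exp x ≤ 1 := exp_le_one_iff.mpr (by linarith)
      nlinarith

theorem exp_mul_le_one_add {θ y : ℝ} (h0 : 0 ≤ θ) (h1 : θ ≤ 1) :
    exp (θ * y) ≤ 1 + θ * (exp y - 1) := by
  have h := convexOn_exp.2 (Set.mem_univ (0 : ℝ)) (Set.mem_univ y) (sub_nonneg.mpr h1) h0 (by ring)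
  simp only [smul_eq_mul, mul_zero, zero_add, exp_zero] at h
  linarith

variable {Ω : Type*} [MeasurableSpace Ω] {P : Measure Ω}

/-- Layer cake: `𝔼 exp(X²/2K) - 1 = ∫ ℙ(|X| > t) (t/K) exp(t²/2K) dt ≤ e ∫ (t/K) exp(-t²/2K) dt = e`
over `t > 0`. -/
theorem integral_exp_sq_le [IsProbabilityMeasure P] {K : ℝ} (hK : 0 < K) {X : Ω → ℝ}
    (hX : Measurable X)
    (htail : ∀ t : ℝ, 0 ≤ t → P.real {ω | t < |X ω|} ≤ exp (1 - t ^ 2 / K)) :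
    Integrable (fun ω => exp (X ω ^ 2 / (2 * K))) P ∧
      ∫ ω, exp (X ω ^ 2 / (2 * K)) ∂P ≤ 1 + exp 1 := by
  have hd : ∀ t : ℝ, HasDerivAt (fun t => exp (t ^ 2 / (2 * K)))
      (t / K * exp (t ^ 2 / (2 * K))) t := by
    intro t
    have := (((hasDerivAt_id t).pow 2).div_const (2 * K)).exp
    convert! this using 1
    simp
    field_simp
  have hd' : ∀ t : ℝ, HasDerivAt (fun t => -exp (-(t ^ 2 / (2 * K))))
      (t / K * exp (-(t ^ 2 / (2 * K)))) t := by
    intro t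
    have := ((((hasDerivAt_id t).pow 2).div_const (2 * K)).neg.exp).neg
    convert! this using 1
    simp
    field_simp
  have hcont : Continuous fun t : ℝ => t / K * exp (t ^ 2 / (2 * K)) := by fun_prop
  have hlim : Filter.Tendsto (fun t : ℝ => -exp (-(t ^ 2 / (2 * K)))) Filter.atTop (nhds 0) := by
    rw [← neg_zero]
    refine (tendsto_exp_neg_atTop_nhds_zero.comp ?_).neg
    exact (Filter.tendsto_pow_atTop two_ne_zero).atTop_div_const (by positivity)
  have hpos : ∀ t ∈ Set.Ioi (0 : ℝ), 0 ≤ t / K * exp (-(t ^ 2 / (2 * K))) := fun t ht => by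
    have : (0 : ℝ) < t := ht
    positivity
  have hint := integrableOn_Ioi_deriv_of_nonneg' (fun x _ => hd' x) hpos hlim
  have hval := integral_Ioi_of_hasDerivAt_of_nonneg' (fun x _ => hd' x) hpos hlim
  have hlc := lintegral_comp_eq_lintegral_meas_lt_mul (f := fun ω => |X ω|)
    (g := fun t : ℝ => t / K * exp (t ^ 2 / (2 * K))) P (ae_of_all _ fun ω => abs_nonneg (X ω))
    hX.abs.aemeasurable (fun t _ => hcont.intervalIntegrable _ _)
    ((ae_restrict_iff' measurableSet_Ioi).mpr (ae_of_all _ fun t ht => by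
      have : (0 : ℝ) < t := ht
      positivity))
  have hleft : ∀ ω, ∫ t in (0 : ℝ)..|X ω|, t / K * exp (t ^ 2 / (2 * K)) =
      exp (X ω ^ 2 / (2 * K)) - 1 := by
    intro ω
    rw [intervalIntegral.integral_eq_sub_of_hasDerivAt (fun t _ => hd t)
      (hcont.intervalIntegrable _ _)]
    simp
  simp only [hleft] at hlc
  have hbound : ∫⁻ ω, ENNReal.ofReal (exp (X ω ^ 2 / (2 * K)) - 1) ∂P ≤ ENNReal.ofReal (exp 1) := by
    rw [hlc]
    calc ∫⁻ t in Set.Ioi (0 : ℝ), P {ω | t < |X ω|} * ENNReal.ofReal (t / K * exp (t ^ 2 / (2 * K)))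
        ≤ ∫⁻ t in Set.Ioi (0 : ℝ),
            ENNReal.ofReal (exp 1 * (t / K * exp (-(t ^ 2 / (2 * K))))) := by
          refine setLIntegral_mono' measurableSet_Ioi fun t ht => ?_
          have ht0 : (0 : ℝ) < t := ht
          have h1 : P {ω | t < |X ω|} ≤ ENNReal.ofReal (exp (1 - t ^ 2 / K)) := by
            rw [← ofReal_measureReal]
            exact ENNReal.ofReal_le_ofReal (htail t ht0.le)
          calc _ ≤ ENNReal.ofReal (exp (1 - t ^ 2 / K)) *
                ENNReal.ofReal (t / K * exp (t ^ 2 / (2 * K))) := by gcongr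
            _ = _ := by
                rw [← ENNReal.ofReal_mul (exp_pos _).le]
                congr 1
                have : exp (1 - t ^ 2 / K) * exp (t ^ 2 / (2 * K)) =
                    exp 1 * exp (-(t ^ 2 / (2 * K))) := by
                  rw [← exp_add, ← exp_add]
                  congr 1
                  field_simp
                  ring
                linear_combination (t / K) * this
      _ = ENNReal.ofReal (exp 1) := by
          rw [← ofReal_integral_eq_lintegral_ofReal (hint.const_mul _)
            ((ae_restrict_iff' measurableSet_Ioi).mpr (ae_of_all _ fun t ht =>
              mul_nonneg (exp_pos _).le (hpos t ht))), integral_const_mul, hval]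
          simp
  have hnn : ∀ ω, 0 ≤ exp (X ω ^ 2 / (2 * K)) - 1 := fun ω =>
    sub_nonneg.mpr (one_le_exp (by positivity))
  have hmeas : Measurable fun ω => exp (X ω ^ 2 / (2 * K)) - 1 := by fun_prop
  have hI : Integrable (fun ω => exp (X ω ^ 2 / (2 * K)) - 1) P :=
    ⟨hmeas.aestronglyMeasurable, (hasFiniteIntegral_iff_ofReal (ae_of_all _ hnn)).mpr
      (hbound.trans_lt ENNReal.ofReal_lt_top)⟩
  have hI' : Integrable (fun ω => exp (X ω ^ 2 / (2 * K))) P := by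
    have := hI.add (integrable_const (1 : ℝ))
    refine this.congr (ae_of_all _ fun ω => ?_)
    simp
  refine ⟨hI', ?_⟩
  have h2 : ∫ ω, (exp (X ω ^ 2 / (2 * K)) - 1) ∂P ≤ exp 1 := by
    rw [integral_eq_lintegral_of_nonneg_ae (ae_of_all _ hnn) hmeas.aestronglyMeasurable]
    exact ENNReal.toReal_le_of_le_ofReal (exp_pos _).le hbound
  rw [integral_sub hI' (integrable_const _)] at h2
  simp at h2
  linarith

theorem hasSubgaussianMGF_of_tail [IsProbabilityMeasure P] {K : ℝ≥0} (hK : 0 < K) {X : Ω → ℝ}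
    (hX : Measurable X) (hmean : ∫ ω, X ω ∂P = 0)
    (htail : ∀ t : ℝ, 0 ≤ t → P.real {ω | t < |X ω|} ≤ exp (1 - t ^ 2 / K)) :
    HasSubgaussianMGF X (12 * K) P := by
  have hK' : (0 : ℝ) < K := by exact_mod_cast hK
  obtain ⟨hI, hle⟩ := integral_exp_sq_le hK' hX htail
  have hamgm : ∀ s x : ℝ, s * x ≤ K * s ^ 2 / 2 + x ^ 2 / (2 * K) := by
    intro s x
    have : K * s ^ 2 / 2 + x ^ 2 / (2 * K) - s * x = (K * s - x) ^ 2 / (2 * K) := by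
      field_simp
      ring
    have h2 : 0 ≤ (K * s - x) ^ 2 / (2 * K) := by positivity
    linarith
  have hexp : ∀ s x : ℝ, exp (s * x) ≤ exp (K * s ^ 2 / 2) * exp (x ^ 2 / (2 * K)) := fun s x => by
    rw [← exp_add]
    exact exp_le_exp.mpr (hamgm s x)
  have hint : ∀ s : ℝ, Integrable (fun ω => exp (s * X ω)) P := fun s => by
    refine (hI.const_mul (exp (K * s ^ 2 / 2))).mono' (by fun_prop) (ae_of_all _ fun ω => ?_)
    rw [norm_of_nonneg (exp_pos _).le]
    exact hexp s (X ω)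
  have hXint : Integrable X P := by
    refine ((hint 1).add (hint (-1))).mono' hX.aestronglyMeasurable (ae_of_all _ fun ω => ?_)
    have h1 := add_one_le_exp (1 * X ω)
    have h2 := add_one_le_exp (-1 * X ω)
    have h3 := exp_pos (1 * X ω)
    have h4 := exp_pos (-1 * X ω)
    simp only [Pi.add_apply, norm_eq_abs, abs_le]
    constructor <;> linarith
  have he : exp 1 < 2.7182818286 := exp_one_lt_d9
  refine ⟨hint, fun s => ?_⟩
  simp only [mgf]
  push_cast
  -- For small `s` the vanishing mean yields `1 + 2eKs² ≤ exp(6Ks²)`. For large `s` the weighted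
  -- AM–GM bound gives `exp(Ks²/2 + e)`, and `11Ks²/2 > 11/4 > e`; this fixes the constant `12`.
  rcases le_or_gt (2 * K * s ^ 2) 1 with h | h
  · have hpt : ∀ x : ℝ, exp (s * x) ≤
        s * x + (1 + 2 * K * s ^ 2 * (exp (x ^ 2 / (2 * K)) - 1)) := by
      intro x
      refine (exp_le_add_exp_sq _).trans ?_
      have h1 := exp_mul_le_one_add (θ := 2 * K * s ^ 2) (y := x ^ 2 / (2 * K)) (by positivity) h
      have h2 : 2 * K * s ^ 2 * (x ^ 2 / (2 * K)) = (s * x) ^ 2 := by field_simp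
      rw [h2] at h1
      linarith
    have hI2 : Integrable (fun ω => 2 * K * s ^ 2 * (exp (X ω ^ 2 / (2 * K)) - 1)) P :=
      (hI.sub (integrable_const 1)).const_mul _
    have hI3 : Integrable (fun ω => 1 + 2 * K * s ^ 2 * (exp (X ω ^ 2 / (2 * K)) - 1)) P :=
      (integrable_const 1).add hI2
    calc ∫ ω, exp (s * X ω) ∂P
        ≤ ∫ ω, (s * X ω + (1 + 2 * K * s ^ 2 * (exp (X ω ^ 2 / (2 * K)) - 1))) ∂P :=
          integral_mono (hint s) ((hXint.const_mul s).add hI3) fun ω => hpt (X ω)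
      _ = 1 + 2 * K * s ^ 2 * (∫ ω, exp (X ω ^ 2 / (2 * K)) ∂P - 1) := by
          rw [integral_add (hXint.const_mul s) hI3, integral_add (integrable_const 1) hI2,
            integral_const_mul, integral_const_mul, hmean, integral_sub hI (integrable_const 1)]
          simp
      _ ≤ 1 + 2 * K * s ^ 2 * exp 1 := by
          gcongr
          linarith
      _ ≤ 1 + 12 * K * s ^ 2 / 2 := by
          have : 0 ≤ K * s ^ 2 := by positivity
          nlinarith
      _ ≤ exp (12 * K * s ^ 2 / 2) := by
          rw [add_comm]
          exact add_one_le_exp _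
  · calc ∫ ω, exp (s * X ω) ∂P
        ≤ ∫ ω, exp (K * s ^ 2 / 2) * exp (X ω ^ 2 / (2 * K)) ∂P :=
          integral_mono (hint s) (hI.const_mul _) fun ω => hexp s (X ω)
      _ ≤ exp (K * s ^ 2 / 2) * exp (exp 1) := by
          rw [integral_const_mul]
          gcongr
          have := add_one_le_exp (exp 1)
          linarith
      _ ≤ exp (12 * K * s ^ 2 / 2) := by
          rw [← exp_add]
          apply exp_le_exp.mpr
          nlinarith [exp_pos 1]

/-- Linear combinations of independent random variables over disjoint blocks are independent. -/
theorem iIndepFun_sum_mul {ι κ : Type*} [Fintype ι] {ξ : ι → Ω → ℝ} (hξ : iIndepFun ξ P)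
    (hm : ∀ p, Measurable (ξ p)) {c : κ → ι → ℝ}
    (hc : ∀ j j' p, c j p ≠ 0 → c j' p ≠ 0 → j = j') :
    iIndepFun (fun j ω => ∑ p, c j p * ξ p ω) P := by
  classical
  have := hξ.isProbabilityMeasure
  rw [iIndepFun_iff_measure_inter_preimage_eq_mul]
  intro s B hB
  induction s using Finset.induction_on with
  | empty => simp
  | insert a s ha ih =>
    have hB' : ∀ i ∈ s, MeasurableSet (B i) := fun i hi => hB i (Finset.mem_insert_of_mem hi)
    rw [Finset.prod_insert ha, ← ih hB', Finset.set_biInter_insert]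
    -- The new combination and the earlier ones depend on disjoint sets of the independent
    -- variables.
    set S := Finset.univ.filter fun p => c a p ≠ 0
    set T := Finset.univ.filter fun p => ∃ j ∈ s, c j p ≠ 0
    have hST : Disjoint S T := by
      rw [Finset.disjoint_filter]
      rintro p _ h1 ⟨j, hj, h2⟩
      exact ha (hc a j p h1 h2 ▸ hj)
    have hind := hξ.indepFun_finset S T hST hm
    let f : (S → ℝ) → ℝ := fun x => ∑ p : S, c a p * x p
    let g : (T → ℝ) → (s → ℝ) := fun x j => ∑ p : T, c j p * x p
    have hf : Measurable f := by fun_prop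
    have hg : Measurable g := by fun_prop
    have hind2 := hind.comp hf hg
    have e1 : (fun ω => ∑ p, c a p * ξ p ω) = f ∘ fun ω (p : S) => ξ p ω := by
      ext ω
      simp only [f, Function.comp]
      rw [Finset.sum_coe_sort S (fun p => c a p * ξ p ω)]
      symm
      apply Finset.sum_subset (Finset.subset_univ _)
      intro p _ hp
      have : c a p = 0 := by
        by_contra h
        exact hp (by simpa [S] using h)
      simp [this]
    have e2 : (fun ω (j : s) => ∑ p, c j p * ξ p ω) = g ∘ fun ω (p : T) => ξ p ω := by
      ext ω j
      simp only [g, Function.comp]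
      rw [Finset.sum_coe_sort T (fun p => c j p * ξ p ω)]
      symm
      apply Finset.sum_subset (Finset.subset_univ _)
      intro p _ hp
      have : c j p = 0 := by
        by_contra h
        apply hp
        simp only [T, Finset.mem_filter, Finset.mem_univ, true_and]
        exact ⟨j, j.2, h⟩
      simp [this]
    rw [← e1, ← e2] at hind2
    have hms : MeasurableSet (Set.pi Set.univ fun j : s => B j) :=
      MeasurableSet.univ_pi fun j => hB' j j.2
    have h3 := hind2.measure_inter_preimage_eq_mul _ _ (hB a (Finset.mem_insert_self a s)) hms
    have e3 : (fun ω (j : s) => ∑ p, c j p * ξ p ω) ⁻¹' (Set.pi Set.univ fun j : s => B j) =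
        ⋂ i ∈ s, (fun ω => ∑ p, c i p * ξ p ω) ⁻¹' B i := by
      ext ω
      simp [Set.mem_pi]
    rw [e3] at h3
    exact h3

theorem HasSubgaussianMGF.mono {X : Ω → ℝ} {c c' : ℝ≥0} (h : HasSubgaussianMGF X c P)
    (hc : c ≤ c') : HasSubgaussianMGF X c' P :=
  ⟨h.integrable_exp_mul, fun t => (h.mgf_le t).trans (by gcongr)⟩

theorem hasSubgaussianMGF_sum_mul {ι : Type*} [Fintype ι] {X : ι → Ω → ℝ} {c ρ : ℝ≥0}
    (hind : iIndepFun X P) (hX : ∀ i, HasSubgaussianMGF (X i) c P) (a : ι → ℝ)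
    (ha : ∑ i, a i ^ 2 ≤ ρ) : HasSubgaussianMGF (fun ω => ∑ i, a i * X i ω) (ρ * c) P := by
  have h1 : ∀ i, HasSubgaussianMGF (fun ω => a i * X i ω) (‖a i‖₊ ^ 2 * c) P := by
    intro i
    refine HasSubgaussianMGF.mono ((hX i).const_mul (a i)) (le_of_eq ?_)
    congr 1
    ext
    rw [NNReal.coe_pow, coe_nnnorm, Real.norm_eq_abs, sq_abs]
    rfl
  have h2 := HasSubgaussianMGF.sum_of_iIndepFun (s := Finset.univ)
    (hind.comp (fun i x => a i * x) fun i => by fun_prop) fun i _ => h1 i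
  refine HasSubgaussianMGF.mono h2 ?_
  rw [← Finset.sum_mul]
  refine mul_le_mul_left ?_ c
  rw [← NNReal.coe_le_coe]
  push_cast
  simpa using ha

theorem integral_pow_four_le {X : Ω → ℝ} {c : ℝ≥0} (h : HasSubgaussianMGF X c P) :
    Integrable (fun ω => X ω ^ 4) P ∧ ∫ ω, X ω ^ 4 ∂P ≤ 48 * exp (c / 2) := by
  have hpt : ∀ x : ℝ, x ^ 4 ≤ 24 * (exp (1 * x) + exp (-1 * x)) := by
    intro x
    have h1 := pow_div_factorial_le_exp |x| (abs_nonneg x) 4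
    have h2 : exp |x| ≤ exp (1 * x) + exp (-1 * x) := by
      rcases abs_cases x with ⟨h, -⟩ | ⟨h, -⟩ <;> rw [h]
      · rw [one_mul]; linarith [exp_pos (-1 * x)]
      · rw [neg_one_mul]; linarith [exp_pos (1 * x)]
    have h3 : |x| ^ 4 = x ^ 4 := by rw [Even.pow_abs]; decide
    have h4 : ((Nat.factorial 4 : ℕ) : ℝ) = 24 := by norm_num [Nat.factorial]
    rw [h3, h4, div_le_iff₀ (by norm_num)] at h1
    linarith
  have hI := ((h.integrable_exp_mul 1).add (h.integrable_exp_mul (-1))).const_mul 24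
  have hI4 : Integrable (fun ω => X ω ^ 4) P := by
    refine hI.mono' (h.aestronglyMeasurable.pow 4) (ae_of_all _ fun ω => ?_)
    rw [norm_of_nonneg (by positivity)]
    exact hpt (X ω)
  refine ⟨hI4, ?_⟩
  calc ∫ ω, X ω ^ 4 ∂P ≤ ∫ ω, 24 * (exp (1 * X ω) + exp (-1 * X ω)) ∂P :=
        integral_mono hI4 hI fun ω => hpt (X ω)
    _ = 24 * (mgf X P 1 + mgf X P (-1)) := by
        rw [integral_const_mul, integral_add (h.integrable_exp_mul 1) (h.integrable_exp_mul (-1))]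
        rfl
    _ ≤ 24 * (exp (c * 1 ^ 2 / 2) + exp (c * (-1) ^ 2 / 2)) := by
        gcongr
        · exact h.mgf_le 1
        · exact h.mgf_le (-1)
    _ = 48 * exp (c / 2) := by
        norm_num
        ring

theorem exp_neg_le {x : ℝ} (hx : 0 ≤ x) : exp (-x) ≤ 1 - x + x ^ 2 / 2 := by
  have h1 := quadratic_le_exp_of_nonneg hx
  have h2 : exp (-x) * exp x = 1 := by rw [← exp_add]; simp
  have h3 := exp_pos (-x)
  have h4 : exp (-x) * (1 + x + x ^ 2 / 2) ≤ 1 := by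
    calc exp (-x) * (1 + x + x ^ 2 / 2) ≤ exp (-x) * exp x := by gcongr
      _ = 1 := h2
  have h5 : 1 ≤ (1 - x + x ^ 2 / 2) * (1 + x + x ^ 2 / 2) := by nlinarith [sq_nonneg (x ^ 2)]
  have h6 : 0 < 1 + x + x ^ 2 / 2 := by positivity
  exact le_of_mul_le_mul_right (h4.trans h5) h6

variable [IsProbabilityMeasure P] {l : ℕ} {Y : Fin l → Ω → ℝ} {c : ℝ≥0}

/-- Chernoff for nonnegative variables, with second and fourth moments only: `𝔼 exp(-sY²) ≤ 1 - sv +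
s²M/2`. The choice `s = v/M` gives `exp(-v²/2M)` per factor, and the threshold `v/4` gives back half
of the exponent. -/
theorem measureReal_sum_sq_lt_le (hind : iIndepFun Y P) (hm : ∀ j, Measurable (Y j))
    (hY : ∀ j, HasSubgaussianMGF (Y j) c P) {v : ℝ} (hv : 0 < v)
    (hvar : ∀ j, v ≤ ∫ ω, Y j ω ^ 2 ∂P) :
    P.real {ω | ∑ j, Y j ω ^ 2 < v / 4 * l} ≤ exp (-(v ^ 2 / (192 * exp (c / 2)) * l)) := by
  set M := 48 * exp (c / 2) with hM
  have hM0 : 0 < M := by positivity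
  set s := v / M with hs
  have hs0 : 0 < s := by positivity
  have hI2 : ∀ j, Integrable (fun ω => Y j ω ^ 2) P := fun j => ((hY j).memLp 2).integrable_sq
  have hone : ∀ j, ∫ ω, exp (-(s * Y j ω ^ 2)) ∂P ≤ exp (-(v ^ 2 / (2 * M))) := by
    intro j
    obtain ⟨hI4, h4⟩ := integral_pow_four_le (hY j)
    have hIa : Integrable (fun ω => 1 - s * Y j ω ^ 2) P :=
      (integrable_const 1).sub ((hI2 j).const_mul s)
    have hIb : Integrable (fun ω => s ^ 2 / 2 * Y j ω ^ 4) P := hI4.const_mul _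
    have hIe : Integrable (fun ω => exp (-(s * Y j ω ^ 2))) P := by
      refine (integrable_const (1 : ℝ)).mono' ?_ (ae_of_all _ fun ω => ?_)
      · have := hm j
        fun_prop
      · rw [norm_of_nonneg (exp_pos _).le]
        exact exp_le_one_iff.mpr (by have := sq_nonneg (Y j ω); nlinarith)
    calc ∫ ω, exp (-(s * Y j ω ^ 2)) ∂P
        ≤ ∫ ω, ((1 - s * Y j ω ^ 2) + s ^ 2 / 2 * Y j ω ^ 4) ∂P := by
          refine integral_mono hIe (hIa.add hIb) fun ω => ?_
          refine (exp_neg_le (by positivity)).trans (le_of_eq ?_)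
          ring
      _ = 1 - s * ∫ ω, Y j ω ^ 2 ∂P + s ^ 2 / 2 * ∫ ω, Y j ω ^ 4 ∂P := by
          rw [integral_add hIa hIb, integral_sub (integrable_const 1) ((hI2 j).const_mul s),
            integral_const_mul, integral_const_mul]
          simp
      _ ≤ 1 - s * v + s ^ 2 / 2 * M := by
          have := hvar j
          gcongr
      _ = -(v ^ 2 / (2 * M)) + 1 := by
          rw [hs]
          field_simp
          ring
      _ ≤ _ := add_one_le_exp _
  have hprod : ∫ ω, ∏ j, exp (-(s * Y j ω ^ 2)) ∂P = ∏ j, ∫ ω, exp (-(s * Y j ω ^ 2)) ∂P :=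
    hind.integral_fun_prod_comp (f := fun _ x => exp (-(s * x ^ 2)))
      (fun j => (hm j).aemeasurable) fun j => Measurable.aestronglyMeasurable (by fun_prop)
  have hIprod : Integrable (fun ω => exp (-s * ∑ j, Y j ω ^ 2)) P := by
    refine (integrable_const (1 : ℝ)).mono' ?_ (ae_of_all _ fun ω => ?_)
    · fun_prop
    · rw [norm_of_nonneg (exp_pos _).le]
      have : 0 ≤ ∑ j, Y j ω ^ 2 := Finset.sum_nonneg fun j _ => sq_nonneg _
      exact exp_le_one_iff.mpr (by nlinarith)
  have hcher := measure_le_le_exp_mul_mgf (X := fun ω => ∑ j, Y j ω ^ 2) (μ := P) (v / 4 * l)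
    (t := -s) (by linarith) hIprod
  have hmgf : mgf (fun ω => ∑ j, Y j ω ^ 2) P (-s) ≤ exp (-(v ^ 2 / (2 * M))) ^ l := by
    have e1 : mgf (fun ω => ∑ j, Y j ω ^ 2) P (-s) = ∫ ω, ∏ j, exp (-(s * Y j ω ^ 2)) ∂P := by
      simp only [mgf]
      congr 1
      ext ω
      rw [← exp_sum, Finset.mul_sum]
      congr 1
      exact Finset.sum_congr rfl fun j _ => by ring
    rw [e1, hprod]
    calc ∏ j, ∫ ω, exp (-(s * Y j ω ^ 2)) ∂P ≤ ∏ _j : Fin l, exp (-(v ^ 2 / (2 * M))) :=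
          Finset.prod_le_prod (fun j _ => integral_nonneg fun ω => (exp_pos _).le) fun j _ => hone j
      _ = _ := by simp
  calc P.real {ω | ∑ j, Y j ω ^ 2 < v / 4 * l}
      ≤ P.real {ω | ∑ j, Y j ω ^ 2 ≤ v / 4 * l} := by
        refine measureReal_mono (fun ω hω => ?_) (measure_ne_top _ _)
        exact le_of_lt (show ∑ j, Y j ω ^ 2 < v / 4 * l from hω)
    _ ≤ exp (- -s * (v / 4 * l)) * exp (-(v ^ 2 / (2 * M))) ^ l := hcher.trans (by gcongr)
    _ = exp (-(v ^ 2 / (192 * exp (c / 2)) * l)) := by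
        rw [← exp_nat_mul, ← exp_add, show 192 * exp ((c : ℝ) / 2) = 4 * M by rw [hM]; ring, hs]
        congr 1
        field_simp
        ring

/-- A large Euclidean norm forces a large inner product with some point of `intNet l`. Each is
sub-Gaussian with parameter `4lc`, and a union bound over the net concludes. -/
theorem measureReal_lt_sum_sq_le (hind : iIndepFun Y P)
    (hY : ∀ j, HasSubgaussianMGF (Y j) c P) {β : ℝ} (hβ : 0 ≤ β) :
    P.real {ω | β ^ 2 * l < ∑ j, Y j ω ^ 2} ≤ 48 ^ l * exp (-(β ^ 2 * l / (8 * c))) := by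
  have hsub : {ω | β ^ 2 * l < ∑ j, Y j ω ^ 2} ⊆
      ⋃ z ∈ intNet l, {ω | β * l ≤ ∑ j, (z j : ℝ) * Y j ω} := by
    intro ω hω
    by_contra hcon
    simp only [Set.mem_iUnion, exists_prop, not_exists, not_and] at hcon
    have h1 := dotProduct_self_le_of_intNet (y := fun j => Y j ω) (β := β) fun z hz => by
      have h2 := hcon z hz
      rw [Set.mem_ofPred_eq, not_le] at h2
      exact h2.le
    have h3 : β ^ 2 * l < ∑ j, Y j ω ^ 2 := hω
    simp only [dotProduct, ← pow_two] at h1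
    linarith
  have hz : ∀ z ∈ intNet l, P.real {ω | β * l ≤ ∑ j, (z j : ℝ) * Y j ω} ≤
      exp (-(β ^ 2 * l / (8 * c))) := by
    intro z hz
    have h2 := hasSubgaussianMGF_sum_mul hind hY (castVec z) (ρ := 4 * l) (by
      push_cast
      have := castVec_dotProduct_self_le hz
      simpa only [dotProduct, ← pow_two] using this)
    have h4 := h2.measure_ge_le (ε := β * l) (by positivity)
    refine h4.trans (exp_le_exp.mpr (le_of_eq ?_))
    push_cast
    rcases Nat.eq_zero_or_pos l with h0 | h0
    · simp [h0]
    · have : (l : ℝ) ≠ 0 := by positivity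
      rcases eq_or_ne (c : ℝ) 0 with hc | hc
      · simp [hc]
      · field_simp
        ring
  calc P.real {ω | β ^ 2 * l < ∑ j, Y j ω ^ 2}
      ≤ P.real (⋃ z ∈ intNet l, {ω | β * l ≤ ∑ j, (z j : ℝ) * Y j ω}) :=
        measureReal_mono hsub (measure_ne_top _ _)
    _ ≤ ∑ z ∈ intNet l, P.real {ω | β * l ≤ ∑ j, (z j : ℝ) * Y j ω} :=
        measureReal_biUnion_finset_le _ _
    _ ≤ ∑ z ∈ intNet l, exp (-(β ^ 2 * l / (8 * c))) := Finset.sum_le_sum hz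
    _ ≤ 48 ^ l * exp (-(β ^ 2 * l / (8 * c))) := by
        rw [Finset.sum_const, nsmul_eq_mul]
        gcongr
        exact card_intNet_le l

end Probability

/-! ### The averaged measurements -/

theorem measure_add {m n₁ n₂ : ℕ} (A : Fin m → Matrix (Fin n₁) (Fin n₂) ℝ)
    (X Y : Matrix (Fin n₁) (Fin n₂) ℝ) : measure A (X + Y) = measure A X + measure A Y := by
  ext i
  simp [measure, add_mul, Finset.sum_add_distrib]

theorem measure_smul {m n₁ n₂ : ℕ} (A : Fin m → Matrix (Fin n₁) (Fin n₂) ℝ) (t : ℝ)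
    (X : Matrix (Fin n₁) (Fin n₂) ℝ) : measure A (t • X) = t • measure A X := by
  ext i
  simp [measure, mul_assoc, Finset.mul_sum]

theorem mulVec_measure_apply {l m n₁ n₂ : ℕ} (T : Matrix (Fin l) (Fin m) ℝ)
    (A : Fin m → Matrix (Fin n₁) (Fin n₂) ℝ) (Z : Matrix (Fin n₁) (Fin n₂) ℝ) (j : Fin l) :
    (T *ᵥ measure A Z) j =
      ∑ p : Fin m × Fin n₁ × Fin n₂, (T j p.1 * Z p.2.1 p.2.2) * A p.1 p.2.1 p.2.2 := by
  simp only [mulVec, dotProduct, measure, Fintype.sum_prod_type, Finset.mul_sum]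
  refine Finset.sum_congr rfl fun i _ => Finset.sum_congr rfl fun a _ =>
    Finset.sum_congr rfl fun b _ => by ring

theorem sum_sq_coeff_eq {l m n₁ n₂ : ℕ} (T : Matrix (Fin l) (Fin m) ℝ)
    (Z : Matrix (Fin n₁) (Fin n₂) ℝ) (j : Fin l) :
    ∑ p : Fin m × Fin n₁ × Fin n₂, (T j p.1 * Z p.2.1 p.2.2) ^ 2 =
      (∑ i, T j i ^ 2) * hsInner Z Z := by
  rw [hsInner_eq_sum, Finset.sum_mul, Fintype.sum_prod_type]
  simp only [Fintype.sum_prod_type, Finset.mul_sum]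
  refine Finset.sum_congr rfl fun i _ => Finset.sum_congr rfl fun a _ =>
    Finset.sum_congr rfl fun b _ => by ring

/-- The quadratic form `|T M(Z)|² - t |Z|_F²`, as a bilinear form. -/
def defectForm {l m n₁ n₂ : ℕ} (T : Matrix (Fin l) (Fin m) ℝ)
    (A : Fin m → Matrix (Fin n₁) (Fin n₂) ℝ) (t : ℝ) :
    Matrix (Fin n₁) (Fin n₂) ℝ →ₗ[ℝ] Matrix (Fin n₁) (Fin n₂) ℝ →ₗ[ℝ] ℝ :=
  LinearMap.mk₂ ℝ
    (fun Z W => (T *ᵥ measure A Z) ⬝ᵥ (T *ᵥ measure A W) - t * hsInner Z W)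
    (fun Z Z' W => by
      rw [measure_add, mulVec_add, add_dotProduct, hsInner_add_left]
      ring)
    (fun c Z W => by
      rw [measure_smul, mulVec_smul, smul_dotProduct, hsInner_smul_left]
      simp only [smul_eq_mul]
      ring)
    (fun Z W W' => by
      rw [measure_add, mulVec_add, dotProduct_add, hsInner_add_right]
      ring)
    (fun c Z W => by
      rw [measure_smul, mulVec_smul, dotProduct_smul, hsInner_smul_right]
      simp only [smul_eq_mul]
      ring)

theorem defectForm_apply {l m n₁ n₂ : ℕ} (T : Matrix (Fin l) (Fin m) ℝ)
    (A : Fin m → Matrix (Fin n₁) (Fin n₂) ℝ) (t : ℝ) (Z W : Matrix (Fin n₁) (Fin n₂) ℝ) :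
    defectForm T A t Z W = (T *ᵥ measure A Z) ⬝ᵥ (T *ᵥ measure A W) - t * hsInner Z W := rfl

/-- Bounds on finitely many matrices imply a restricted eigenvalue inequality for all matrices. -/
theorem restricted_eigenvalue {l m n₁ n₂ N : ℕ} (hn₁ : 0 < n₁) (hn₂ : 0 < n₂) (hN : 0 < N)
    {T : Matrix (Fin l) (Fin m) ℝ} {A : Fin m → Matrix (Fin n₁) (Fin n₂) ℝ} {s t : ℝ} (hs : 0 ≤ s)
    (h1 : ∀ f : Fin N → dictIndex n₁ n₂,
      s * hsInner (∑ i, rankOne (f i : (Fin n₁ → ℤ) × (Fin n₂ → ℤ)))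
        (∑ i, rankOne (f i : (Fin n₁ → ℤ) × (Fin n₂ → ℤ))) ≤
      (T *ᵥ measure A (∑ i, rankOne (f i : (Fin n₁ → ℤ) × (Fin n₂ → ℤ)))) ⬝ᵥ
        (T *ᵥ measure A (∑ i, rankOne (f i : (Fin n₁ → ℤ) × (Fin n₂ → ℤ)))))
    (h2 : ∀ p ∈ dictIndex n₁ n₂,
      (T *ᵥ measure A (rankOne p)) ⬝ᵥ (T *ᵥ measure A (rankOne p)) ≤ t)
    (H : Matrix (Fin n₁) (Fin n₂) ℝ) :
    ((N : ℝ) - 1) * (s * hsInner H H) ≤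
      ((N : ℝ) - 1) * ((T *ᵥ measure A H) ⬝ᵥ (T *ᵥ measure A H)) + t * nuclearNorm H ^ 2 := by
  obtain ⟨x, hx, hH⟩ := exists_mem_convexHull_eq_smul hn₁ hn₂ H
  -- The form is indefinite, but its diagonal on the dictionary is at most `t` because the
  -- subtracted part is nonnegative.
  have hx0 := nonneg_of_mem_convexHull (defectForm T A s) hx (β := t)
    (by
      rintro _ ⟨p, hp, rfl⟩
      rw [defectForm_apply]
      have := mul_nonneg hs (hsInner_self_nonneg (rankOne p : Matrix (Fin n₁) (Fin n₂) ℝ))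
      have := h2 p hp
      linarith) hN
    (by
      intro f hf
      choose g hg hgf using hf
      have := h1 fun i => ⟨g i, hg i⟩
      simp only [hgf] at this
      rw [defectForm_apply]
      linarith)
  set ν := nuclearNorm H
  have h3 : defectForm T A s H H = ν ^ 2 * defectForm T A s x x := by
    rw [hH]
    simp only [map_smul, LinearMap.smul_apply, smul_eq_mul]
    ring
  have h4 := mul_nonneg (sq_nonneg ν) hx0
  rw [defectForm_apply T A s H H] at h3
  nlinarith

/-! ### Tail bounds for the averaged measurements and the union bound -/

section Probability

open MeasureTheory ProbabilityTheory
open scoped NNReal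

variable {Ω : Type*} [MeasurableSpace Ω] {P : MeasureTheory.Measure Ω}
  {l m n₁ n₂ : ℕ} {K : ℝ≥0} {A : Ω → Fin m → Matrix (Fin n₁) (Fin n₂) ℝ}
  {T : Matrix (Fin l) (Fin m) ℝ}

theorem IsSubGaussianMap.measurable_mulVec (hA : IsSubGaussianMap P K A)
    (Z : Matrix (Fin n₁) (Fin n₂) ℝ) (j : Fin l) :
    Measurable fun ω => (T *ᵥ measure (A ω) Z) j := by
  have := fun p : Fin m × Fin n₁ × Fin n₂ => hA.measurable p.1 p.2.1 p.2.2
  simp only [mulVec_measure_apply]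
  fun_prop

theorem IsSubGaussianMap.iIndepFun_mulVec (hA : IsSubGaussianMap P K A)
    (hT : ∀ j j' i, T j i ≠ 0 → T j' i ≠ 0 → j = j') (Z : Matrix (Fin n₁) (Fin n₂) ℝ) :
    iIndepFun (fun j ω => (T *ᵥ measure (A ω) Z) j) P := by
  simp only [mulVec_measure_apply]
  exact iIndepFun_sum_mul hA.indep (fun p => hA.measurable p.1 p.2.1 p.2.2)
    (c := fun j (p : Fin m × Fin n₁ × Fin n₂) => T j p.1 * Z p.2.1 p.2.2)
    fun j j' p h1 h2 => hT j j' p.1 (left_ne_zero_of_mul h1) (left_ne_zero_of_mul h2)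

variable [IsProbabilityMeasure P]

theorem IsSubGaussianMap.hasSubgaussianMGF (hA : IsSubGaussianMap P K A) (hK : 0 < K)
    (p : Fin m × Fin n₁ × Fin n₂) :
    HasSubgaussianMGF (fun ω => A ω p.1 p.2.1 p.2.2) (12 * K) P :=
  hasSubgaussianMGF_of_tail hK (hA.measurable _ _ _) (hA.mean_zero _ _ _) (hA.tail _ _ _)

theorem IsSubGaussianMap.hasSubgaussianMGF_mulVec (hA : IsSubGaussianMap P K A) (hK : 0 < K)
    (hT1 : ∀ j, ∑ i, T j i ^ 2 ≤ 1) {Z : Matrix (Fin n₁) (Fin n₂) ℝ} {ρ : ℝ≥0}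
    (hZ : hsInner Z Z ≤ ρ) (j : Fin l) :
    HasSubgaussianMGF (fun ω => (T *ᵥ measure (A ω) Z) j) (ρ * (12 * K)) P := by
  simp only [mulVec_measure_apply]
  refine hasSubgaussianMGF_sum_mul hA.indep (hA.hasSubgaussianMGF hK) _ ?_
  rw [sum_sq_coeff_eq]
  have h1 := hT1 j
  have h2 := hsInner_self_nonneg Z
  nlinarith

theorem IsSubGaussianMap.le_integral_sq_mulVec (hA : IsSubGaussianMap P K A) (hK : 0 < K)
    (Z : Matrix (Fin n₁) (Fin n₂) ℝ) (j : Fin l) :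
    (∑ i, T j i ^ 2) * hsInner Z Z ≤ ∫ ω, (T *ᵥ measure (A ω) Z) j ^ 2 ∂P := by
  have hmeas := hA.measurable_mulVec (T := T) Z j
  refine le_trans (le_of_eq ?_) (variance_le_expectation_sq hmeas.aestronglyMeasurable)
  have h1 : (fun ω => (T *ᵥ measure (A ω) Z) j) =
      ∑ p : Fin m × Fin n₁ × Fin n₂, fun ω => (T j p.1 * Z p.2.1 p.2.2) * A ω p.1 p.2.1 p.2.2 := by
    ext ω
    rw [mulVec_measure_apply, Finset.sum_apply]
  rw [h1, IndepFun.variance_sum, ← sum_sq_coeff_eq]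
  · refine Finset.sum_congr rfl fun p _ => ?_
    rw [variance_const_mul, hA.unit_variance, mul_one]
  · intro p _
    exact ((hA.hasSubgaussianMGF hK p).memLp 2).const_mul _
  · intro p _ q _ hpq
    exact (hA.indep.indepFun hpq).comp
      (φ := fun x => (T j p.1 * Z p.2.1 p.2.2) * x) (ψ := fun x => (T j q.1 * Z q.2.1 q.2.2) * x)
      (by fun_prop) (by fun_prop)

/-- The rate in the bound on the lower tail. -/
def rate (K v : ℝ) : ℝ := v ^ 2 / (192 * Real.exp (12 * K / 2))

theorem IsSubGaussianMap.measureReal_lower_le (hA : IsSubGaussianMap P K A) (hK : 0 < K)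
    (hT : ∀ j j' i, T j i ≠ 0 → T j' i ≠ 0 → j = j') {v : ℝ} (hv : 0 < v)
    (hT0 : ∀ j, v ≤ ∑ i, T j i ^ 2) (hT1 : ∀ j, ∑ i, T j i ^ 2 ≤ 1)
    (Z : Matrix (Fin n₁) (Fin n₂) ℝ) :
    P.real {ω | (T *ᵥ measure (A ω) Z) ⬝ᵥ (T *ᵥ measure (A ω) Z) < v / 4 * l * hsInner Z Z} ≤
      Real.exp (-(rate K v * l)) := by
  rcases (hsInner_self_nonneg Z).eq_or_lt with h0 | h0
  · have : {ω | (T *ᵥ measure (A ω) Z) ⬝ᵥ (T *ᵥ measure (A ω) Z) <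
        v / 4 * l * hsInner Z Z} = ∅ := by
      ext ω
      simp only [← h0, mul_zero, Set.mem_ofPred_eq, Set.mem_empty_iff_false, iff_false, not_lt]
      exact zero_le_dotProduct_self _
    rw [this, measureReal_empty]
    exact (Real.exp_pos _).le
  -- By homogeneity `Z` may be taken of Frobenius norm one.
  · set ρ := (√(hsInner Z Z))⁻¹ with hρ
    have hρ2 : ρ ^ 2 * hsInner Z Z = 1 := by
      rw [hρ, inv_pow, Real.sq_sqrt h0.le, inv_mul_cancel₀ h0.ne']
    set W := ρ • Z with hW
    have hWW : hsInner W W = 1 := by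
      rw [hW, hsInner_smul_left, hsInner_smul_right, ← mul_assoc, ← pow_two, hρ2]
    have h1 := measureReal_sum_sq_lt_le (hA.iIndepFun_mulVec hT W) (hA.measurable_mulVec W)
      (c := 12 * K) (fun j => by
        have := hA.hasSubgaussianMGF_mulVec hK hT1 (Z := W) (ρ := 1) (by rw [hWW]; simp) j
        rwa [one_mul] at this) hv (fun j => by
        have := hA.le_integral_sq_mulVec (T := T) hK W j
        rw [hWW, mul_one] at this
        exact (hT0 j).trans this)
    have h2 : {ω | (T *ᵥ measure (A ω) Z) ⬝ᵥ (T *ᵥ measure (A ω) Z) < v / 4 * l * hsInner Z Z} =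
        {ω | ∑ j, (T *ᵥ measure (A ω) W) j ^ 2 < v / 4 * l} := by
      ext ω
      have e1 : ∑ j, (T *ᵥ measure (A ω) W) j ^ 2 =
          ρ ^ 2 * ((T *ᵥ measure (A ω) Z) ⬝ᵥ (T *ᵥ measure (A ω) Z)) := by
        rw [hW, measure_smul, mulVec_smul, dotProduct, Finset.mul_sum]
        refine Finset.sum_congr rfl fun j _ => ?_
        simp only [Pi.smul_apply, smul_eq_mul]
        ring
      have hρ0 : 0 < ρ ^ 2 := by
        by_contra! h
        nlinarith
      rw [Set.mem_ofPred_eq, Set.mem_ofPred_eq, e1, ← mul_lt_mul_iff_right₀ hρ0]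
      have e2 : ρ ^ 2 * (v / 4 * l * hsInner Z Z) = v / 4 * l := by
        linear_combination (v / 4 * l) * hρ2
      rw [e2]
    rw [h2]
    simpa [rate] using h1

theorem IsSubGaussianMap.measureReal_upper_le (hA : IsSubGaussianMap P K A) (hK : 0 < K)
    (hT : ∀ j j' i, T j i ≠ 0 → T j' i ≠ 0 → j = j')
    (hT1 : ∀ j, ∑ i, T j i ^ 2 ≤ 1) {Z : Matrix (Fin n₁) (Fin n₂) ℝ} (hZ : hsInner Z Z ≤ 16)
    {b : ℝ} (hb : 0 ≤ b) :
    P.real {ω | b * l < (T *ᵥ measure (A ω) Z) ⬝ᵥ (T *ᵥ measure (A ω) Z)} ≤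
      48 ^ l * Real.exp (-(b * l / (1536 * K))) := by
  -- The sub-Gaussian parameter is `16 · 12K`, and `8 · 16 · 12 = 1536`.
  have h1 := measureReal_lt_sum_sq_le (hA.iIndepFun_mulVec hT Z)
    (hA.hasSubgaussianMGF_mulVec hK hT1 (ρ := 16) (by simpa using hZ)) (Real.sqrt_nonneg b)
  rw [Real.sq_sqrt hb] at h1
  simp only [dotProduct, ← pow_two]
  refine h1.trans (le_of_eq ?_)
  congr 4
  push_cast
  ring

theorem pow_le_exp (n : ℕ) : (48 : ℝ) ^ n ≤ Real.exp (4 * n) := by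
  rw [mul_comm, Real.exp_nat_mul]
  refine pow_le_pow_left₀ (by norm_num) ?_ n
  have h1 : Real.exp 4 = Real.exp 1 ^ 4 := by
    rw [← Real.exp_nat_mul]
    norm_num
  have h2 := Real.exp_one_gt_d9
  rw [h1]
  calc (48 : ℝ) ≤ 2.7182818283 ^ 4 := by norm_num
    _ ≤ _ := by gcongr

/-- With high probability, the averaged measurements satisfy a restricted eigenvalue inequality. -/
theorem IsSubGaussianMap.exists_event (hA : IsSubGaussianMap P K A) (hK : 0 < K)
    (hT : ∀ j j' i, T j i ≠ 0 → T j' i ≠ 0 → j = j') {v : ℝ} (hv : 0 < v)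
    (hT0 : ∀ j, v ≤ ∑ i, T j i ^ 2) (hT1 : ∀ j, ∑ i, T j i ^ 2 ≤ 1) (hn₁ : 0 < n₁) (hn₂ : 0 < n₂)
    {N : ℕ} (hN : 0 < N) (hNl : 8 * ((n₁ + n₂ : ℕ) : ℝ) * N ≤ rate K v * l)
    (hnl : 4 * ((n₁ + n₂ : ℕ) : ℝ) ≤ l) :
    ∃ E : Set Ω, MeasurableSet E ∧ 1 - 3 * Real.exp (-(rate K v / 2) * l) < P.real E ∧
      ∀ ω ∈ E, ∀ H, ((N : ℝ) - 1) * (v / 4 * l * hsInner H H) ≤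
        ((N : ℝ) - 1) * ((T *ᵥ measure (A ω) H) ⬝ᵥ (T *ᵥ measure (A ω) H)) +
          1536 * K * (5 + rate K v) * l * nuclearNorm H ^ 2 := by
  have hK' : (0 : ℝ) < K := by exact_mod_cast hK
  have hr0 : 0 < rate K v := by rw [rate]; positivity
  -- Makes the upper tail `exp(-(5 + rate) l)`: `4l` pays for `48^l` and `l` for the size of the
  -- dictionary.
  set b := 1536 * K * (5 + rate K v) with hb
  have hb0 : 0 < b := by positivity
  let S : (Fin N → dictIndex n₁ n₂) → Matrix (Fin n₁) (Fin n₂) ℝ := fun f =>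
    ∑ i, rankOne (f i : (Fin n₁ → ℤ) × (Fin n₂ → ℤ))
  let B₁ : (Fin N → dictIndex n₁ n₂) → Set Ω := fun f =>
    {ω | (T *ᵥ measure (A ω) (S f)) ⬝ᵥ (T *ᵥ measure (A ω) (S f)) <
      v / 4 * l * hsInner (S f) (S f)}
  let B₂ : (Fin n₁ → ℤ) × (Fin n₂ → ℤ) → Set Ω := fun p =>
    {ω | b * l < (T *ᵥ measure (A ω) (rankOne p)) ⬝ᵥ (T *ᵥ measure (A ω) (rankOne p))}
  have hmeas : ∀ Z : Matrix (Fin n₁) (Fin n₂) ℝ,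
      Measurable fun ω => (T *ᵥ measure (A ω) Z) ⬝ᵥ (T *ᵥ measure (A ω) Z) := by
    intro Z
    have := hA.measurable_mulVec (T := T) Z
    simp only [dotProduct]
    fun_prop
  have hB₁ : ∀ f, MeasurableSet (B₁ f) := fun f => measurableSet_lt (hmeas _) measurable_const
  have hB₂ : ∀ p, MeasurableSet (B₂ p) := fun p => measurableSet_lt measurable_const (hmeas _)
  set F := (⋃ f ∈ Finset.univ, B₁ f) ∪ ⋃ p ∈ dictIndex n₁ n₂, B₂ p with hF
  have hFm : MeasurableSet F :=
    (Finset.measurableSet_biUnion _ fun f _ => hB₁ f).union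
      (Finset.measurableSet_biUnion _ fun p _ => hB₂ p)
  have hdict : ((dictIndex n₁ n₂).card : ℝ) ≤ Real.exp (4 * (n₁ + n₂ : ℕ)) :=
    (card_dictIndex_le _ _).trans (pow_le_exp _)
  have hF₁ : P.real (⋃ f ∈ Finset.univ, B₁ f) ≤ Real.exp (-(rate K v / 2) * l) := by
    calc P.real (⋃ f ∈ Finset.univ, B₁ f) ≤ ∑ f, P.real (B₁ f) := measureReal_biUnion_finset_le _ _
      _ ≤ ∑ _f : Fin N → dictIndex n₁ n₂, Real.exp (-(rate K v * l)) :=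
          Finset.sum_le_sum fun f _ => hA.measureReal_lower_le hK hT hv hT0 hT1 (S f)
      _ = ((dictIndex n₁ n₂).card : ℝ) ^ N * Real.exp (-(rate K v * l)) := by
          simp
      _ ≤ Real.exp (4 * (n₁ + n₂ : ℕ)) ^ N * Real.exp (-(rate K v * l)) := by gcongr
      -- By `hNl`, choosing `N` dictionary elements costs at most half of the exponent.
      _ ≤ Real.exp (-(rate K v / 2) * l) := by
          rw [← Real.exp_nat_mul, ← Real.exp_add]
          apply Real.exp_le_exp.mpr
          nlinarith
  have hF₂ : P.real (⋃ p ∈ dictIndex n₁ n₂, B₂ p) ≤ Real.exp (-(rate K v / 2) * l) := by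
    calc P.real (⋃ p ∈ dictIndex n₁ n₂, B₂ p) ≤ ∑ p ∈ dictIndex n₁ n₂, P.real (B₂ p) :=
          measureReal_biUnion_finset_le _ _
      _ ≤ ∑ _p ∈ dictIndex n₁ n₂, 48 ^ l * Real.exp (-(b * l / (1536 * K))) :=
          Finset.sum_le_sum fun p hp =>
            hA.measureReal_upper_le hK hT hT1 (hsInner_rankOne_le hp) hb0.le
      _ = (dictIndex n₁ n₂).card * (48 ^ l * Real.exp (-(b * l / (1536 * K)))) := by
          simp
      _ ≤ Real.exp (4 * (n₁ + n₂ : ℕ)) * (Real.exp (4 * l) *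
            Real.exp (-(b * l / (1536 * K)))) := by
          gcongr
          exact pow_le_exp l
      _ ≤ Real.exp (-(rate K v / 2) * l) := by
          rw [← Real.exp_add, ← Real.exp_add]
          apply Real.exp_le_exp.mpr
          have h1 : b * l / (1536 * K) = (5 + rate K v) * l := by
            rw [hb]
            field_simp
          rw [h1]
          have h2 : 0 ≤ rate K v * l := by positivity
          nlinarith
  refine ⟨Fᶜ, hFm.compl, ?_, ?_⟩
  · rw [probReal_compl_eq_one_sub hFm]
    have h1 := measureReal_union_le (μ := P) (⋃ f ∈ Finset.univ, B₁ f) (⋃ p ∈ dictIndex n₁ n₂, B₂ p)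
    rw [← hF] at h1
    have h2 := Real.exp_pos (-(rate K v / 2) * l)
    -- The two bad events cost two exponentials; the third makes the inequality strict.
    linarith
  · intro ω hω H
    simp only [hF, Set.mem_compl_iff, Set.mem_union, Set.mem_iUnion, not_or, not_exists,
      Finset.mem_univ] at hω
    refine restricted_eigenvalue hn₁ hn₂ hN (by positivity) (fun f => ?_) (fun p hp => ?_) H
    · have h1 := hω.1 f trivial
      exact not_lt.mp h1
    · exact not_lt.mp (hω.2 p hp)

end Probability

/-! ### The decoder -/

theorem l2Norm_eq_norm {m : ℕ} (v : Fin m → ℝ) : l2Norm v = ‖WithLp.toLp 2 v‖ := by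
  rw [EuclideanSpace.norm_eq, l2Norm]
  simp

theorem l2Norm_nonneg {m : ℕ} (v : Fin m → ℝ) : 0 ≤ l2Norm v := Real.sqrt_nonneg _

theorem l2Norm_sub_le {m : ℕ} (v w : Fin m → ℝ) : l2Norm (v - w) ≤ l2Norm v + l2Norm w := by
  simp only [l2Norm_eq_norm, WithLp.toLp_sub]
  exact norm_sub_le _ _

theorem sq_l2Norm {m : ℕ} (v : Fin m → ℝ) : l2Norm v ^ 2 = v ⬝ᵥ v := by
  rw [l2Norm, Real.sq_sqrt (Finset.sum_nonneg fun i _ => sq_nonneg _)]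
  simp only [dotProduct, pow_two]

theorem l2Norm_le_of_dotProduct_le {l m : ℕ} {v : Fin l → ℝ} {w : Fin m → ℝ} {t : ℝ} (ht : 0 ≤ t)
    (h : v ⬝ᵥ v ≤ t ^ 2 * (w ⬝ᵥ w)) : l2Norm v ≤ t * l2Norm w := by
  apply le_of_sq_le_sq _ (mul_nonneg ht (l2Norm_nonneg w))
  rw [mul_pow, sq_l2Norm, sq_l2Norm]
  exact h

theorem l2Norm_le_of_abs_le {m : ℕ} {v : Fin m → ℝ} {t : ℝ} (ht : 0 ≤ t) (h : ∀ i, |v i| ≤ t) :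
    l2Norm v ≤ t * √(m : ℝ) := by
  rw [l2Norm, ← Real.sqrt_sq ht, ← Real.sqrt_mul (sq_nonneg t)]
  apply Real.sqrt_le_sqrt
  calc ∑ i, v i ^ 2 ≤ ∑ _i : Fin m, t ^ 2 := Finset.sum_le_sum fun i _ => sq_le_sq'
        (abs_le.mp (h i)).1 (abs_le.mp (h i)).2
    _ = t ^ 2 * m := by simp [mul_comm]

theorem isUnit_det_diffMatrix_pow (m r : ℕ) : IsUnit (diffMatrix m ^ r).det := by
  rw [det_pow, det_diffMatrix, one_pow]
  exact isUnit_one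

theorem SigmaDeltaScheme.IsRun.isFeasible {r m n₁ n₂ : ℕ} {S : SigmaDeltaScheme r}
    {A : Fin m → Matrix (Fin n₁) (Fin n₂) ℝ} {X : Matrix (Fin n₁) (Fin n₂) ℝ} {e u q : Fin m → ℝ}
    {τ ε : ℝ} (hrun : S.IsRun (measure A X + e) u q) (hτ : 0 ≤ τ) (hu : ∀ i, |u i| ≤ τ)
    (he : ‖e‖ ≤ ε) : IsFeasible A r τ ε q X e := by
  have hε : 0 ≤ ε := (norm_nonneg e).trans he
  refine ⟨?_, l2Norm_le_of_abs_le hε fun i => (norm_le_pi_norm e i).trans he⟩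
  rw [hrun.state, mulVec_mulVec, nonsing_inv_mul _ (isUnit_det_diffMatrix_pow m r), one_mulVec]
  exact l2Norm_le_of_abs_le hτ hu

theorem measure_sub {m n₁ n₂ : ℕ} (A : Fin m → Matrix (Fin n₁) (Fin n₂) ℝ)
    (X Y : Matrix (Fin n₁) (Fin n₂) ℝ) : measure A (X - Y) = measure A X - measure A Y := by
  rw [eq_sub_iff_add_eq, ← measure_add, sub_add_cancel]

/-- The averaged measurements of the difference of two feasible points are small. -/
theorem l2Norm_mulVec_measure_sub_le {l m n₁ n₂ r : ℕ} {T : Matrix (Fin l) (Fin m) ℝ}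
    {A : Fin m → Matrix (Fin n₁) (Fin n₂) ℝ} {τ ε g : ℝ} {q ν ν' : Fin m → ℝ}
    {X X' : Matrix (Fin n₁) (Fin n₂) ℝ} (hg : 0 ≤ g) (hT : IsContraction T)
    (hTD : ∀ u, (T *ᵥ (diffMatrix m ^ r *ᵥ u)) ⬝ᵥ (T *ᵥ (diffMatrix m ^ r *ᵥ u)) ≤
      g ^ 2 * (u ⬝ᵥ u))
    (h : IsFeasible A r τ ε q X ν) (h' : IsFeasible A r τ ε q X' ν') :
    l2Norm (T *ᵥ measure A (X' - X)) ≤ g * (2 * τ * √(m : ℝ)) + 2 * ε * √(m : ℝ) := by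
  set D := diffMatrix m ^ r with hD
  set w := measure A X + ν - q
  set w' := measure A X' + ν' - q
  have hDD : ∀ z, D *ᵥ (D⁻¹ *ᵥ z) = z := fun z => by
    rw [mulVec_mulVec, mul_nonsing_inv _ (isUnit_det_diffMatrix_pow m r), one_mulVec]
  -- The quantized data `q` cancel in `w' - w`, leaving a quantization part in the range of `D` and
  -- a noise part.
  have e1 : T *ᵥ measure A (X' - X) =
      T *ᵥ (D *ᵥ (D⁻¹ *ᵥ w' - D⁻¹ *ᵥ w)) - T *ᵥ (ν' - ν) := by
    rw [← mulVec_sub, ← mulVec_sub, hDD, measure_sub]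
    congr 1
    simp only [w, w']
    abel
  have h1 := l2Norm_le_of_dotProduct_le hg (hTD (D⁻¹ *ᵥ w' - D⁻¹ *ᵥ w))
  have h2 : l2Norm (T *ᵥ (ν' - ν)) ≤ 1 * l2Norm (ν' - ν) :=
    l2Norm_le_of_dotProduct_le zero_le_one (by simpa using hT (ν' - ν))
  have h3 := l2Norm_sub_le (D⁻¹ *ᵥ w') (D⁻¹ *ᵥ w)
  have h4 := l2Norm_sub_le ν' ν
  rw [e1]
  refine (l2Norm_sub_le _ _).trans (add_le_add (h1.trans ?_) (h2.trans ?_))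
  · exact mul_le_mul_of_nonneg_left (by linarith [h.1, h'.1]) hg
  · linarith [h.2, h'.2]

/-- From the restricted eigenvalue inequality to the error. -/
theorem le_of_restricted_eigenvalue {a b l k N F G σ ν : ℝ} (ha : 0 < a) (hb : 0 < b) (hl : 0 < l)
    (hk : 0 < k) (hG : 0 ≤ G) (hσ : 0 ≤ σ) (hν : 0 ≤ ν) (hN : 64 * k * b ≤ N * a)
    (h1 : N * (a * l * F ^ 2) ≤ N * G ^ 2 + b * l * ν ^ 2) (h2 : ν ≤ 4 * √k * F + 2 * σ) :
    F ≤ √(2 / a) * (G / √l) + σ / √k := by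
  have hN0 : 0 < N := by
    by_contra! h
    have : 0 < 64 * k * b := by positivity
    nlinarith
  have h3 : ν ^ 2 ≤ 32 * k * F ^ 2 + 8 * σ ^ 2 := by
    have h4 : ν ^ 2 ≤ (4 * √k * F + 2 * σ) ^ 2 := pow_le_pow_left₀ hν h2 2
    have h5 : √k ^ 2 = k := Real.sq_sqrt hk.le
    nlinarith [sq_nonneg (4 * √k * F - 2 * σ)]
  -- In the loss, `32k F²` is exactly what `64kb ≤ Na` lets half of the left side absorb. Here `N`
  -- stands for the number of summands minus one.
  have h4 : N * (a * l * F ^ 2) ≤ N * (G ^ 2 + a * l * F ^ 2 / 2 + a * l * σ ^ 2 / (8 * k)) := by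
    have h5 : b * l * ν ^ 2 ≤ b * l * (32 * k * F ^ 2 + 8 * σ ^ 2) := by gcongr
    have h6 : b * l * (32 * k * F ^ 2 + 8 * σ ^ 2) =
        (64 * k * b) * (l * (F ^ 2 / 2 + σ ^ 2 / (8 * k))) := by
      field_simp
      ring
    have h7 : (64 * k * b) * (l * (F ^ 2 / 2 + σ ^ 2 / (8 * k))) ≤
        (N * a) * (l * (F ^ 2 / 2 + σ ^ 2 / (8 * k))) := by gcongr
    have h8 : (N * a) * (l * (F ^ 2 / 2 + σ ^ 2 / (8 * k))) =
        N * (a * l * F ^ 2 / 2 + a * l * σ ^ 2 / (8 * k)) := by ring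
    linarith
  have h5 := le_of_mul_le_mul_left h4 hN0
  have h6 : F ^ 2 ≤ 2 / a * (G ^ 2 / l) + σ ^ 2 / k := by
    have h7 : a * l * F ^ 2 ≤ 2 * G ^ 2 + a * l * (σ ^ 2 / k) := by
      have h8 : a * l * σ ^ 2 / (8 * k) = a * l * (σ ^ 2 / k) / 8 := by field_simp
      have h9 : 0 ≤ a * l * (σ ^ 2 / k) := by positivity
      rw [h8] at h5
      linarith
    have h8 : a * l * F ^ 2 ≤ a * l * (2 / a * (G ^ 2 / l) + σ ^ 2 / k) := by
      refine h7.trans (le_of_eq ?_)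
      field_simp
    exact le_of_mul_le_mul_left h8 (by positivity)
  apply le_of_sq_le_sq _ (by positivity)
  refine h6.trans ?_
  have e1 : √(2 / a) ^ 2 = 2 / a := Real.sq_sqrt (by positivity)
  have e2 : √l ^ 2 = l := Real.sq_sqrt hl.le
  have e3 : √k ^ 2 = k := Real.sq_sqrt hk.le
  rw [add_sq, mul_pow, div_pow, div_pow, e1, e2, e3]
  have : 0 ≤ 2 * (√(2 / a) * (G / √l)) * (σ / √k) := by positivity
  linarith

theorem frobeniusNorm_eq_zero_of_eq_zero_or {n₁ n₂ : ℕ} (h : n₁ = 0 ∨ n₂ = 0)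
    (A : Matrix (Fin n₁) (Fin n₂) ℝ) : frobeniusNorm A = 0 := by
  rcases h with rfl | rfl <;> simp [frobeniusNorm]

end LowRankSD

end

/-! ### Choice of constants and conclusion -/

open Matrix LowRankSD in
theorem theorem3p1 (K : ℝ) (hK : 0 < K) (r : ℕ) (hr : 1 ≤ r) :
    ∃ c₁ c₂ c₃ : ℝ, 0 < c₁ ∧ 0 < c₂ ∧ 0 < c₃ ∧
    ∀ γ : ℝ, 0 < γ → ∃ C : ℝ, 0 < C ∧
    ∀ (n₁ n₂ m k ℓ : ℕ), 1 ≤ k → c₁ * (k : ℝ) * (max n₁ n₂ : ℕ) ≤ (ℓ : ℝ) → ℓ ≤ m →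
    ∀ (Ω : Type*) [MeasurableSpace Ω] (P : MeasureTheory.Measure Ω)
      [MeasureTheory.IsProbabilityMeasure P]
      (A : Ω → Fin m → Matrix (Fin n₁) (Fin n₂) ℝ),
      LowRankSD.IsSubGaussianMap P K A →
    ∃ E : Set Ω, MeasurableSet E ∧ 1 - c₂ * Real.exp (-c₃ * (ℓ : ℝ)) < P.real E ∧
    ∀ ω ∈ E,
    ∀ (S : LowRankSD.SigmaDeltaScheme r) (μ : ℝ), S.IsStable μ (γ * S.step) →
    ∀ (ε : ℝ) (X : Matrix (Fin n₁) (Fin n₂) ℝ) (e : Fin m → ℝ),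
      0 ≤ ε → ‖e‖ ≤ ε → ‖LowRankSD.measure (A ω) X + e‖ ≤ μ →
    ∀ q : Fin m → ℝ, S.IsQuantization (LowRankSD.measure (A ω) X + e) q →
    ∀ (X' : Matrix (Fin n₁) (Fin n₂) ℝ) (ν' : Fin m → ℝ),
      LowRankSD.IsDecoderSolution (A ω) r (γ * S.step) ε q X' ν' →
      LowRankSD.frobeniusNorm (X' - X) ≤
        C * (((m : ℝ) / (ℓ : ℝ)) ^ (-(r : ℝ) + 1 / 2) * S.step
          + LowRankSD.bestRankError k X / √(k : ℝ)
          + √((m : ℝ) / (ℓ : ℝ)) * ε) := by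
  set v : ℝ := 1 / ((r : ℝ) + 1) with hv
  have hv0 : 0 < v := by positivity
  set κ := rate K v with hκ
  have hκ0 : 0 < κ := by rw [hκ, rate]; positivity
  set a := v / 4 with ha
  have ha0 : 0 < a := by positivity
  set b := 1536 * K * (5 + κ) with hb
  have hb0 : 0 < b := by positivity
  -- the number of matrices of rank one in the approximating sums, divided by `k`
  set M := 64 * b / a + 2 with hM
  have hM0 : 0 < M := by positivity
  -- With `n₁ + n₂ ≤ 2 max n₁ n₂` and `N ≤ Mk`, the term `16M/κ` yields `8(n₁ + n₂)N ≤ κℓ`, and `8`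
  -- yields `4(n₁ + n₂) ≤ ℓ`.
  refine ⟨16 * M / κ + 8, 3, κ / 2, by positivity, by norm_num, by positivity, fun γ hγ => ?_⟩
  set g₀ := (4 * ((r : ℝ) + 1)) ^ r with hg₀
  have hg₀0 : 0 < g₀ := by positivity
  set C := √(2 / a) * (2 * γ * g₀ + 2) + 1 with hC
  have hC0 : 0 < C := by positivity
  refine ⟨C, hC0, fun n₁ n₂ m k l hk hl hlm Ω _ P _ A hA => ?_⟩
  -- For empty matrices the error is zero; the dictionary argument needs positive dimensions.
  by_cases hn : n₁ = 0 ∨ n₂ = 0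
  · refine ⟨Set.univ, MeasurableSet.univ, ?_, ?_⟩
    · have := Real.exp_pos (-(κ / 2) * (l : ℝ))
      rw [MeasureTheory.probReal_univ]
      linarith
    · intro ω _ S μ _ ε X e hε _ _ q _ X' ν' _
      rw [frobeniusNorm_eq_zero_of_eq_zero_or hn]
      have h1 := bestRankError_nonneg k X
      have h2 := S.step_pos
      positivity
  push Not at hn
  have hn₁ : 0 < n₁ := Nat.pos_of_ne_zero hn.1
  have hn₂ : 0 < n₂ := Nat.pos_of_ne_zero hn.2
  have hk1 : (1 : ℝ) ≤ k := by exact_mod_cast hk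
  have hnn : ((n₁ + n₂ : ℕ) : ℝ) ≤ 2 * (max n₁ n₂ : ℕ) := by
    have : n₁ + n₂ ≤ 2 * max n₁ n₂ := by omega
    exact_mod_cast this
  have hmax : (1 : ℝ) ≤ (max n₁ n₂ : ℕ) := by
    have : 1 ≤ max n₁ n₂ := by omega
    exact_mod_cast this
  set n : ℝ := ((max n₁ n₂ : ℕ) : ℝ) with hn_def
  have hkn : n ≤ k * n := le_mul_of_one_le_left (by positivity) hk1
  have hl1 : 8 * (k * n) ≤ l := by
    have : 0 ≤ 16 * M / κ * (k * n) := by positivity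
    linarith
  have hl2 : 16 * M * (k * n) ≤ κ * l := by
    have h1 : 16 * M / κ * (k * n) ≤ l := by linarith
    have h2 : κ * (16 * M / κ * (k * n)) = 16 * M * (k * n) := by field_simp
    rw [← h2]
    gcongr
  have hl0 : (0 : ℝ) < l := by linarith
  have hl0' : 0 < l := by exact_mod_cast hl0
  have hm0 : (0 : ℝ) < m := by exact_mod_cast hl0'.trans_le hlm
  -- The extra summand compensates for the factor `N - 1` in Maurey's bound. It and the rounding are
  -- covered by the `2` in `M`, since `k ≥ 1`.
  set N := ⌈64 * k * b / a⌉₊ + 1 with hN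
  have hN1 : 64 * k * b ≤ ((N : ℝ) - 1) * a := by
    rw [← div_le_iff₀ ha0, hN]
    push_cast
    rw [add_sub_cancel_right]
    exact Nat.le_ceil _
  have hN2 : (N : ℝ) ≤ M * k := by
    have h1 := (Nat.ceil_lt_add_one (show 0 ≤ 64 * k * b / a by positivity)).le
    have h2 : 64 * k * b / a = 64 * b / a * k := by ring
    rw [hN, hM]
    push_cast
    nlinarith
  obtain ⟨T, hT, hT0, hT1, hTc, hTD⟩ := exists_block_averages r hl0' hlm
  obtain ⟨E, hE, hPE, hEω⟩ := IsSubGaussianMap.exists_event (K := ⟨K, hK.le⟩) hA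
    (by exact_mod_cast hK) hT hv0 hT0 hT1 hn₁ hn₂ (N := N) (by omega)
    (by
      calc 8 * ((n₁ + n₂ : ℕ) : ℝ) * N ≤ 8 * (2 * n) * (M * k) := by gcongr
        _ = 16 * M * (k * n) := by ring
        _ ≤ _ := hl2)
    (by linarith)
  refine ⟨E, hE, hPE, fun ω hω S μ hS ε X e hε he hμ q ⟨u, hrun⟩ X' ν' hX' => ?_⟩
  have hβ := S.step_pos
  have hfeas : IsFeasible (A ω) r (γ * S.step) ε q X e :=
    hrun.isFeasible (by positivity) (hS m _ u q hrun hμ) he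
  have hnuc : nuclearNorm (X + (X' - X)) ≤ nuclearNorm X := by
    rw [add_sub_cancel]
    exact hX'.2 X e hfeas
  have hcone := nuclearNorm_le_bestRankError k X (X' - X) hnuc
  have hG := l2Norm_mulVec_measure_sub_le (by positivity) hTc hTD hfeas hX'.1
  have hre := hEω ω hω (X' - X)
  rw [← sq_frobeniusNorm, ← sq_l2Norm] at hre
  have hmain := le_of_restricted_eigenvalue ha0 hb0 hl0 (by linarith)
    (l2Norm_nonneg _) (bestRankError_nonneg k X) (nuclearNorm_nonneg _) hN1 hre hcone
  refine hmain.trans ?_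
  set z := (m : ℝ) / l with hz
  have hz0 : 0 < z := by positivity
  have hsq : √(m : ℝ) / √(l : ℝ) = √z := (Real.sqrt_div hm0.le _).symm
  -- The half in the exponent comes from `√m / √ℓ`: the state is bounded in the sup norm, so its
  -- Euclidean norm carries `√m`.
  have hpow : ((l : ℝ) / m) ^ r * √z = z ^ (-(r : ℝ) + 1 / 2) := by
    rw [Real.rpow_add hz0, Real.rpow_neg hz0.le, Real.rpow_natCast, Real.sqrt_eq_rpow, ← inv_pow,
      hz, inv_div]
  have hGl : l2Norm (T *ᵥ measure (A ω) (X' - X)) / √(l : ℝ) ≤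
      2 * γ * g₀ * (z ^ (-(r : ℝ) + 1 / 2) * S.step) + 2 * (√z * ε) := by
    have h1 : l2Norm (T *ᵥ measure (A ω) (X' - X)) / √(l : ℝ) ≤
        ((4 * ((r : ℝ) + 1) * (l / m)) ^ r * (2 * (γ * S.step) * √(m : ℝ)) + 2 * ε * √(m : ℝ)) /
          √(l : ℝ) := by gcongr
    refine h1.trans (le_of_eq ?_)
    rw [← hpow, ← hsq, mul_pow]
    ring
  have h1 : 0 ≤ z ^ (-(r : ℝ) + 1 / 2) * S.step := by positivity
  have h2 : 0 ≤ √z * ε := by positivity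
  have h3 : 0 ≤ bestRankError k X / √(k : ℝ) :=
    div_nonneg (bestRankError_nonneg k X) (Real.sqrt_nonneg _)
  have hs : 0 ≤ √(2 / a) := Real.sqrt_nonneg _
  set p := z ^ (-(r : ℝ) + 1 / 2) * S.step
  set w := √z * ε
  set σ := bestRankError k X / √(k : ℝ)
  calc √(2 / a) * (l2Norm (T *ᵥ measure (A ω) (X' - X)) / √(l : ℝ)) + σ
      ≤ √(2 / a) * (2 * γ * g₀ * p + 2 * w) + σ := by gcongr
    _ ≤ C * (p + σ + w) := by
        have e1 : C * (p + σ + w) - (√(2 / a) * (2 * γ * g₀ * p + 2 * w) + σ) =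
            √(2 / a) * (2 * γ * g₀ * (σ + w) + 2 * (p + σ)) + p + w := by
          rw [hC]
          ring
        have e2 : 0 ≤ √(2 / a) * (2 * γ * g₀ * (σ + w) + 2 * (p + σ)) + p + w := by positivity
        linarith
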